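/- Let $K$ be a field. For a $K$-coalgebra $C$ let $\mathbf M^C$ be the category of right $C$-comodules; $C$ is called right semiperfect if $\mathbf M^C$ has enough projectives. A comodule $M\in\mathbf M^C$ is called quasi-finite if the functor $-\otimes M:\mathrm{Vect}_K\to\mathbf M^C$ has a left adjoint, which is then denoted $H_C(M,-)$. For a coalgebra morphism $\alpha:C\to D$ let $\alpha^*:\mathbf M^C\to\mathbf M^D$, $(M,\rho)\mapsto(M,(\mathrm{id}\otimes\alpha)\rho)$, be the corestriction functor. If $C=\alpha^*C$ is quasi-finite as a right $D$-comodule, then $H_D(C,N)$ is naturally a right $C$-comodule for every $N\in\mathbf M^D$, and $\alpha^!:=H_D(C,-):\mathbf M^D\to\mathbf M^C$ is left adjoint to $\alpha^*$; in this situation $\alpha$ is called $\Sigma$-injective if the direct sum $C^{(\Lambda)}$ is an injective right $D$-comodule for every set $\Lambda$ (equivalently, $\alpha^!$ is exact). Let $\mathscr X$ be a poset, regarded as a small category, and let $\mathcal C:\mathscr X\to\mathrm{Coalg}_K$ be a functor such that each $\mathcal C_x$ is right semiperfect and such that, for each morphism $\alpha:x\to y$ of $\mathscr X$, the morphism $\mathcal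 C_\alpha:\mathcal C_x\to\mathcal C_y$ makes $\mathcal C_x$ a quasi-finite right $\mathcal C_y$-comodule and is $\Sigma$-injective. Write $\alpha^*,\alpha^!$ for $(\mathcal C_\alpha)^*,(\mathcal C_\alpha)^!$. A trans-comodule $\mathcal M$ over $\mathcal C$ consists of a right $\mathcal C_x$-comodule $\mathcal M_x$ for each $x\in\mathscr X$ and a morphism ${}_\alpha\mathcal M:\mathcal M_y\to\alpha^*\mathcal M_x$ in $\mathbf M^{\mathcal C_y}$ for each $\alpha:x\to y$, equivalently a morphism ${}^\alpha\mathcal M:\alpha^!\mathcal M_y\to\mathcal M_x$ in $\mathbf M^{\mathcal C_x}$, such that ${}_{\mathrm{id}_x}\mathcal M=\mathrm{id}$ and ${}_{\beta\alpha}\mathcal M=\beta^*({}_\alpha\mathcal M)\circ{}_\beta\mathcal M$ for all $x\xrightarrow{\alpha}y\xrightarrow{\beta}z$. A morphism $\eta:\mathcal M\to\mathcal N$ is a family of morphisms $\eta_x:\mathcal M_x\to\mathcal N_x$ in $\mathbf M^{\mathcal C_x}$ with $\alpha^*(\eta_x)\circ{}_\alpha\mathcal M={}_\alpha\mathcal N\circ\eta_y$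 for each $\alpha:x\to y$. The trans-comodule $\mathcal M$ is cartesian if ${}^\alpha\mathcal M:\alpha^!\mathcal M_y\to\mathcal M_x$ is an isomorphism for each $\alpha:x\to y$. Then the full subcategory $Com^{tr}_c\text{-}\mathcal C$ of cartesian trans-comodules is a Grothendieck category (an abelian category with exact filtered colimits and a generator). -/

import Mathlib

open CategoryTheory TensorProduct

universe u

noncomputable section

/-! ### Linear algebra identities used to build comodules -/

namespace ComodAux

variable {K : Type u} [Field K]
variable {C : Type u} [AddCommGroup C] [Module K C]
variable {D : Type u} [AddCommGroup D] [Module K D]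
variable {M : Type u} [AddCommGroup M] [Module K M]
variable {N : Type u} [AddCommGroup N] [Module K N]
variable {V : Type u} [AddCommGroup V] [Module K V]

theorem assoc_lTensor (f : C →ₗ[K] D) (ρ : M →ₗ[K] M ⊗[K] C) (t : M ⊗[K] C) :
    TensorProduct.assoc K M D D ((f.lTensor M ∘ₗ ρ).rTensor D (f.lTensor M t)) =
      (TensorProduct.map f f).lTensor M (TensorProduct.assoc K M C C (ρ.rTensor C t)) := by
  induction t using TensorProduct.induction_on with
  | zero => simp only [map_zero]
  | add a b ha hb => simp only [map_add, ha, hb]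
  | tmul m c =>
    simp only [LinearMap.lTensor_tmul, LinearMap.rTensor_tmul, LinearMap.comp_apply]
    induction ρ m using TensorProduct.induction_on with
    | zero => simp only [map_zero, TensorProduct.zero_tmul]
    | add a b ha hb => simp only [map_add, TensorProduct.add_tmul, ha, hb]
    | tmul a b => simp only [LinearMap.lTensor_tmul, TensorProduct.assoc_tmul,
        TensorProduct.map_tmul]

theorem assoc_tmul_left (v : V) (s : M ⊗[K] C) (c : C) :
    TensorProduct.assoc K (V ⊗[K] M) C C
        ((TensorProduct.assoc K V M C).symm (v ⊗ₜ[K] s) ⊗ₜ[K] c) =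
      (TensorProduct.assoc K V M (C ⊗[K] C)).symm
        (v ⊗ₜ[K] TensorProduct.assoc K M C C (s ⊗ₜ[K] c)) := by
  induction s using TensorProduct.induction_on with
  | zero => simp only [map_zero, TensorProduct.zero_tmul, TensorProduct.tmul_zero]
  | add a b ha hb =>
    simp only [map_add, TensorProduct.add_tmul, TensorProduct.tmul_add, ha, hb]
  | tmul a b => simp only [TensorProduct.assoc_symm_tmul, TensorProduct.assoc_tmul]

theorem assoc_tensor (ρ : M →ₗ[K] M ⊗[K] C) (v : V) (t : M ⊗[K] C) :
    TensorProduct.assoc K (V ⊗[K] M) C C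
        (((TensorProduct.assoc K V M C).symm.toLinearMap ∘ₗ ρ.lTensor V).rTensor C
          ((TensorProduct.assoc K V M C).symm (v ⊗ₜ[K] t))) =
      (TensorProduct.assoc K V M (C ⊗[K] C)).symm
        (v ⊗ₜ[K] TensorProduct.assoc K M C C (ρ.rTensor C t)) := by
  induction t using TensorProduct.induction_on with
  | zero => simp only [map_zero, TensorProduct.tmul_zero]
  | add a b ha hb => simp only [map_add, TensorProduct.tmul_add, ha, hb]
  | tmul m c =>
    simp only [TensorProduct.assoc_symm_tmul, LinearMap.lTensor_tmul, LinearMap.rTensor_tmul,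
      LinearMap.comp_apply, LinearEquiv.coe_coe]
    exact assoc_tmul_left v (ρ m) c

theorem lTensor_assoc_symm (f : C →ₗ[K] D) (v : V) (t : M ⊗[K] C) :
    f.lTensor (V ⊗[K] M) ((TensorProduct.assoc K V M C).symm (v ⊗ₜ[K] t)) =
      (TensorProduct.assoc K V M D).symm (v ⊗ₜ[K] f.lTensor M t) := by
  induction t using TensorProduct.induction_on with
  | zero => simp only [map_zero, TensorProduct.tmul_zero]
  | add a b ha hb => simp only [map_add, TensorProduct.tmul_add, ha, hb]
  | tmul m c => simp only [TensorProduct.assoc_symm_tmul, LinearMap.lTensor_tmul]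

theorem lTensor_assoc_symm' (f : C →ₗ[K] D) (t : V ⊗[K] (M ⊗[K] C)) :
    f.lTensor (V ⊗[K] M) ((TensorProduct.assoc K V M C).symm t) =
      (TensorProduct.assoc K V M D).symm ((f.lTensor M).lTensor V t) := by
  induction t using TensorProduct.induction_on with
  | zero => simp only [map_zero]
  | add a b ha hb => simp only [map_add, ha, hb]
  | tmul v s => rw [lTensor_assoc_symm, LinearMap.lTensor_tmul]

theorem rTensor_assoc_symm (f : V →ₗ[K] N) (v : V) (t : M ⊗[K] C) :
    (f.rTensor M).rTensor C ((TensorProduct.assoc K V M C).symm (v ⊗ₜ[K] t)) =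
      (TensorProduct.assoc K N M C).symm (f v ⊗ₜ[K] t) := by
  induction t using TensorProduct.induction_on with
  | zero => simp only [map_zero, TensorProduct.tmul_zero]
  | add a b ha hb => simp only [map_add, TensorProduct.tmul_add, ha, hb]
  | tmul m c => simp only [TensorProduct.assoc_symm_tmul, LinearMap.rTensor_tmul]

theorem rTensor_assoc_symm' (f : V →ₗ[K] N) (t : V ⊗[K] (M ⊗[K] C)) :
    (f.rTensor M).rTensor C ((TensorProduct.assoc K V M C).symm t) =
      (TensorProduct.assoc K N M C).symm (f.rTensor (M ⊗[K] C) t) := by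
  induction t using TensorProduct.induction_on with
  | zero => simp only [map_zero]
  | add a b ha hb => simp only [map_add, ha, hb]
  | tmul v s => rw [rTensor_assoc_symm, LinearMap.rTensor_tmul]

theorem rid_lTensor_natural (g : V →ₗ[K] N) (ε : C →ₗ[K] K) (t : V ⊗[K] C) :
    g (TensorProduct.rid K V (ε.lTensor V t)) =
      TensorProduct.rid K N (ε.lTensor N (g.rTensor C t)) := by
  induction t using TensorProduct.induction_on with
  | zero => simp only [map_zero]
  | add a b ha hb => simp only [map_add, ha, hb]
  | tmul v c => simp only [LinearMap.lTensor_tmul, LinearMap.rTensor_tmul, TensorProduct.rid_tmul,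
      map_smul]

theorem assoc_rTensor_rTensor (i : M →ₗ[K] N) (t : (M ⊗[K] C) ⊗[K] D) :
    TensorProduct.assoc K N C D ((i.rTensor C).rTensor D t) =
      i.rTensor (C ⊗[K] D) (TensorProduct.assoc K M C D t) := by
  induction t using TensorProduct.induction_on with
  | zero => simp only [map_zero]
  | add a b ha hb => simp only [map_add, ha, hb]
  | tmul s c =>
    induction s using TensorProduct.induction_on with
    | zero => simp only [map_zero, TensorProduct.zero_tmul]
    | add a b ha hb => simp only [map_add, TensorProduct.add_tmul, ha, hb]
    | tmul a b => simp only [TensorProduct.assoc_tmul, LinearMap.rTensor_tmul]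

theorem lTensor_rTensor (f : C →ₗ[K] D) (i : M →ₗ[K] N) (t : M ⊗[K] C) :
    f.lTensor N (i.rTensor C t) = i.rTensor D (f.lTensor M t) := by
  induction t using TensorProduct.induction_on with
  | zero => simp only [map_zero]
  | add a b ha hb => simp only [map_add, ha, hb]
  | tmul a b => simp only [LinearMap.lTensor_tmul, LinearMap.rTensor_tmul]

theorem tensor_map (f : V →ₗ[K] N) (ρ : M →ₗ[K] M ⊗[K] C) (t : V ⊗[K] M) :
    ((TensorProduct.assoc K N M C).symm.toLinearMap ∘ₗ ρ.lTensor N) (f.rTensor M t) =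
      (f.rTensor M).rTensor C
        (((TensorProduct.assoc K V M C).symm.toLinearMap ∘ₗ ρ.lTensor V) t) := by
  induction t using TensorProduct.induction_on with
  | zero => simp only [map_zero]
  | add a b ha hb => simp only [map_add, ha, hb]
  | tmul v m =>
    have e : ((TensorProduct.assoc K V M C).symm.toLinearMap ∘ₗ ρ.lTensor V) (v ⊗ₜ[K] m) =
      (TensorProduct.assoc K V M C).symm (v ⊗ₜ[K] ρ m) := rfl
    rw [e, rTensor_assoc_symm, LinearMap.rTensor_tmul]
    rfl

/-- The coaction on a direct sum of copies of `M`. -/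
def sumCoact (Λ : Type u) (ρ : M →ₗ[K] M ⊗[K] C) : (Λ →₀ M) →ₗ[K] (Λ →₀ M) ⊗[K] C :=
  Finsupp.lsum K fun i => (Finsupp.lsingle i).rTensor C ∘ₗ ρ

theorem sumCoact_single (Λ : Type u) (ρ : M →ₗ[K] M ⊗[K] C) (i : Λ) (m : M) :
    sumCoact Λ ρ (Finsupp.single i m) = (Finsupp.lsingle (R := K) i).rTensor C (ρ m) := by
  rw [sumCoact, Finsupp.lsum_single, LinearMap.comp_apply]

variable [Coalgebra K C]

theorem corestrict_coassoc [Coalgebra K D] (α : C →ₗc[K] D) (ρ : M →ₗ[K] M ⊗[K] C)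
    (h : ∀ m, TensorProduct.assoc K M C C (ρ.rTensor C (ρ m)) =
      (Coalgebra.comul (R := K) (A := C)).lTensor M (ρ m)) (m : M) :
    TensorProduct.assoc K M D D ((α.toLinearMap.lTensor M ∘ₗ ρ).rTensor D
        ((α.toLinearMap.lTensor M ∘ₗ ρ) m)) =
      (Coalgebra.comul (R := K) (A := D)).lTensor M ((α.toLinearMap.lTensor M ∘ₗ ρ) m) := by
  rw [LinearMap.comp_apply (α.toLinearMap.lTensor M) ρ m, assoc_lTensor α.toLinearMap ρ (ρ m), h m,
    ← LinearMap.lTensor_comp_apply, ← LinearMap.lTensor_comp_apply, α.map_comp_comul]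

theorem corestrict_counit [Coalgebra K D] (α : C →ₗc[K] D) (ρ : M →ₗ[K] M ⊗[K] C)
    (h : ∀ m, (Coalgebra.counit (R := K) (A := C)).lTensor M (ρ m) = m ⊗ₜ[K] (1 : K)) (m : M) :
    (Coalgebra.counit (R := K) (A := D)).lTensor M ((α.toLinearMap.lTensor M ∘ₗ ρ) m) =
      m ⊗ₜ[K] (1 : K) := by
  rw [LinearMap.comp_apply (α.toLinearMap.lTensor M) ρ m, ← LinearMap.lTensor_comp_apply,
    α.counit_comp, h m]

theorem tensor_coassoc (V : Type u) [AddCommGroup V] [Module K V] (ρ : M →ₗ[K] M ⊗[K] C)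
    (h : ∀ m, TensorProduct.assoc K M C C (ρ.rTensor C (ρ m)) =
      (Coalgebra.comul (R := K) (A := C)).lTensor M (ρ m)) (t : V ⊗[K] M) :
    TensorProduct.assoc K (V ⊗[K] M) C C
        (((TensorProduct.assoc K V M C).symm.toLinearMap ∘ₗ ρ.lTensor V).rTensor C
          (((TensorProduct.assoc K V M C).symm.toLinearMap ∘ₗ ρ.lTensor V) t)) =
      (Coalgebra.comul (R := K) (A := C)).lTensor (V ⊗[K] M)
        (((TensorProduct.assoc K V M C).symm.toLinearMap ∘ₗ ρ.lTensor V) t) := by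
  induction t using TensorProduct.induction_on with
  | zero => simp only [map_zero]
  | add a b ha hb => simp only [map_add, ha, hb]
  | tmul v m =>
    have e : ((TensorProduct.assoc K V M C).symm.toLinearMap ∘ₗ ρ.lTensor V) (v ⊗ₜ[K] m) =
      (TensorProduct.assoc K V M C).symm (v ⊗ₜ[K] ρ m) := rfl
    rw [e, assoc_tensor, lTensor_assoc_symm, h]

theorem tensor_counit (V : Type u) [AddCommGroup V] [Module K V] (ρ : M →ₗ[K] M ⊗[K] C)
    (h : ∀ m, (Coalgebra.counit (R := K) (A := C)).lTensor M (ρ m) = m ⊗ₜ[K] (1 : K))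
    (t : V ⊗[K] M) :
    (Coalgebra.counit (R := K) (A := C)).lTensor (V ⊗[K] M)
        (((TensorProduct.assoc K V M C).symm.toLinearMap ∘ₗ ρ.lTensor V) t) = t ⊗ₜ[K] (1 : K) := by
  induction t using TensorProduct.induction_on with
  | zero => simp only [map_zero, TensorProduct.zero_tmul]
  | add a b ha hb => simp only [map_add, TensorProduct.add_tmul, ha, hb]
  | tmul v m =>
    have e : ((TensorProduct.assoc K V M C).symm.toLinearMap ∘ₗ ρ.lTensor V) (v ⊗ₜ[K] m) =
      (TensorProduct.assoc K V M C).symm (v ⊗ₜ[K] ρ m) := rfl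
    rw [e, lTensor_assoc_symm, h, TensorProduct.assoc_symm_tmul]

theorem sum_coassoc (Λ : Type u) (ρ : M →ₗ[K] M ⊗[K] C)
    (h : ∀ m, TensorProduct.assoc K M C C (ρ.rTensor C (ρ m)) =
      (Coalgebra.comul (R := K) (A := C)).lTensor M (ρ m)) (t : Λ →₀ M) :
    TensorProduct.assoc K (Λ →₀ M) C C ((sumCoact Λ ρ).rTensor C (sumCoact Λ ρ t)) =
      (Coalgebra.comul (R := K) (A := C)).lTensor (Λ →₀ M) (sumCoact Λ ρ t) := by
  induction t using Finsupp.induction_linear with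
  | zero => simp only [map_zero]
  | add a b ha hb => simp only [map_add, ha, hb]
  | single i m =>
    have e : sumCoact Λ ρ ∘ₗ Finsupp.lsingle i = (Finsupp.lsingle (R := K) i).rTensor C ∘ₗ ρ :=
      LinearMap.ext fun a => sumCoact_single Λ ρ i a
    rw [sumCoact_single, lTensor_rTensor, ← h, ← assoc_rTensor_rTensor,
      ← LinearMap.rTensor_comp_apply, ← LinearMap.rTensor_comp_apply, e]

theorem sum_counit (Λ : Type u) (ρ : M →ₗ[K] M ⊗[K] C)
    (h : ∀ m, (Coalgebra.counit (R := K) (A := C)).lTensor M (ρ m) = m ⊗ₜ[K] (1 : K))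
    (t : Λ →₀ M) :
    (Coalgebra.counit (R := K) (A := C)).lTensor (Λ →₀ M) (sumCoact Λ ρ t) = t ⊗ₜ[K] (1 : K) := by
  induction t using Finsupp.induction_linear with
  | zero => simp only [map_zero, TensorProduct.zero_tmul]
  | add a b ha hb => simp only [map_add, TensorProduct.add_tmul, ha, hb]
  | single i m =>
    rw [sumCoact_single, lTensor_rTensor, h, LinearMap.rTensor_tmul, Finsupp.lsingle_apply]

variable (K C) in
/-- The map `V ⊗ C → (V ⊗ C) ⊗ C` given by the comultiplication of `C`. -/
def delta (V : Type u) [AddCommGroup V] [Module K V] : V ⊗[K] C →ₗ[K] (V ⊗[K] C) ⊗[K] C :=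
  (TensorProduct.assoc K V C C).symm.toLinearMap ∘ₗ
    (Coalgebra.comul (R := K) (A := C)).lTensor V

theorem delta_apply (t : V ⊗[K] C) : delta K C V t =
    (TensorProduct.assoc K V C C).symm ((Coalgebra.comul (R := K) (A := C)).lTensor V t) := rfl

theorem delta_natural (g : V →ₗ[K] N) (t : V ⊗[K] C) :
    (g.rTensor C).rTensor C (delta K C V t) = delta K C N (g.rTensor C t) := by
  rw [delta_apply, delta_apply, rTensor_assoc_symm', lTensor_rTensor]

theorem rTensor_delta (ρ : M →ₗ[K] M ⊗[K] C)
    (h : ∀ m, TensorProduct.assoc K M C C (ρ.rTensor C (ρ m)) =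
      (Coalgebra.comul (R := K) (A := C)).lTensor M (ρ m)) (m : M) :
    ρ.rTensor C (ρ m) = delta K C M (ρ m) := by
  rw [delta_apply, ← h, LinearEquiv.symm_apply_apply]

theorem delta_coassoc (t : V ⊗[K] C) :
    (TensorProduct.assoc K V C C).toLinearMap.rTensor C
        (delta K C (V ⊗[K] C) (delta K C V t)) =
      ((Coalgebra.comul (R := K) (A := C)).lTensor V).rTensor C (delta K C V t) := by
  have h1 : ∀ (v : V) (s : C ⊗[K] C), (TensorProduct.assoc K V C C).toLinearMap.rTensor C
      (delta K C (V ⊗[K] C) ((TensorProduct.assoc K V C C).symm (v ⊗ₜ[K] s))) =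
      (TensorProduct.assoc K V (C ⊗[K] C) C).symm
        (v ⊗ₜ[K] (TensorProduct.assoc K C C C).symm
          ((Coalgebra.comul (R := K) (A := C)).lTensor C s)) := by
    intro v s
    induction s using TensorProduct.induction_on with
    | zero => simp only [map_zero, TensorProduct.tmul_zero]
    | add a b ha hb => simp only [map_add, TensorProduct.tmul_add, ha, hb]
    | tmul a b =>
      simp only [TensorProduct.assoc_symm_tmul, delta_apply, LinearMap.lTensor_tmul]
      induction Coalgebra.comul (R := K) b using TensorProduct.induction_on with
      | zero => simp only [map_zero, TensorProduct.tmul_zero]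
      | add a b ha hb => simp only [map_add, TensorProduct.tmul_add, ha, hb]
      | tmul x y =>
        simp only [TensorProduct.assoc_symm_tmul, LinearMap.rTensor_tmul, LinearEquiv.coe_coe,
          TensorProduct.assoc_tmul]
  have h2 : ∀ (v : V) (s : C ⊗[K] C),
      ((Coalgebra.comul (R := K) (A := C)).lTensor V).rTensor C
        ((TensorProduct.assoc K V C C).symm (v ⊗ₜ[K] s)) =
      (TensorProduct.assoc K V (C ⊗[K] C) C).symm
        (v ⊗ₜ[K] (Coalgebra.comul (R := K) (A := C)).rTensor C s) := by
    intro v s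
    induction s using TensorProduct.induction_on with
    | zero => simp only [map_zero, TensorProduct.tmul_zero]
    | add a b ha hb => simp only [map_add, TensorProduct.tmul_add, ha, hb]
    | tmul a b =>
      simp only [TensorProduct.assoc_symm_tmul, LinearMap.lTensor_tmul, LinearMap.rTensor_tmul]
  induction t using TensorProduct.induction_on with
  | zero => simp only [map_zero]
  | add a b ha hb => simp only [map_add, ha, hb]
  | tmul v c =>
    have e : delta K C V (v ⊗ₜ[K] c) =
      (TensorProduct.assoc K V C C).symm (v ⊗ₜ[K] Coalgebra.comul (R := K) c) := rfl
    rw [e, h1, h2, Coalgebra.coassoc_symm_apply]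

theorem rTensor_lTensor_counit_delta (t : V ⊗[K] C) :
    ((Coalgebra.counit (R := K) (A := C)).lTensor V).rTensor C (delta K C V t) =
      ((TensorProduct.mk K V K).flip 1).rTensor C t := by
  have h2 : ∀ (v : V) (s : C ⊗[K] C),
      ((Coalgebra.counit (R := K) (A := C)).lTensor V).rTensor C
        ((TensorProduct.assoc K V C C).symm (v ⊗ₜ[K] s)) =
      (TensorProduct.assoc K V K C).symm
        (v ⊗ₜ[K] (Coalgebra.counit (R := K) (A := C)).rTensor C s) := by
    intro v s
    induction s using TensorProduct.induction_on with
    | zero => simp only [map_zero, TensorProduct.tmul_zero]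
    | add a b ha hb => simp only [map_add, TensorProduct.tmul_add, ha, hb]
    | tmul a b =>
      simp only [TensorProduct.assoc_symm_tmul, LinearMap.lTensor_tmul, LinearMap.rTensor_tmul]
  induction t using TensorProduct.induction_on with
  | zero => simp only [map_zero]
  | add a b ha hb => simp only [map_add, ha, hb]
  | tmul v c =>
    have e : delta K C V (v ⊗ₜ[K] c) =
      (TensorProduct.assoc K V C C).symm (v ⊗ₜ[K] Coalgebra.comul (R := K) c) := rfl
    rw [e, h2, Coalgebra.rTensor_counit_comul, TensorProduct.assoc_symm_tmul,
      LinearMap.rTensor_tmul, LinearMap.flip_apply, TensorProduct.mk_apply]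

theorem rid_lTensor_counit_delta (t : V ⊗[K] C) :
    TensorProduct.rid K (V ⊗[K] C)
      ((Coalgebra.counit (R := K) (A := C)).lTensor (V ⊗[K] C) (delta K C V t)) = t := by
  rw [delta, tensor_counit V _ Coalgebra.lTensor_counit_comul, TensorProduct.rid_tmul, one_smul]

theorem coactHom_comm (f : C →ₗ[K] D) (ρ : M →ₗ[K] M ⊗[K] C)
    (h : ∀ m, TensorProduct.assoc K M C C (ρ.rTensor C (ρ m)) =
      (Coalgebra.comul (R := K) (A := C)).lTensor M (ρ m)) (m : M) :
    (TensorProduct.assoc K M C D).symm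
        ((f.lTensor C ∘ₗ Coalgebra.comul (R := K) (A := C)).lTensor M (ρ m)) =
      ρ.rTensor D (f.lTensor M (ρ m)) := by
  rw [LinearMap.lTensor_comp_apply, ← lTensor_assoc_symm', ← delta_apply, ← rTensor_delta ρ h,
    lTensor_rTensor]

theorem lTensor_delta (f : C →ₗ[K] D) (t : V ⊗[K] C) :
    f.lTensor (V ⊗[K] C) (delta K C V t) = (TensorProduct.assoc K V C D).symm
      ((f.lTensor C ∘ₗ Coalgebra.comul (R := K) (A := C)).lTensor V t) := by
  rw [LinearMap.lTensor_comp_apply, ← lTensor_assoc_symm', ← delta_apply]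

theorem rid_counit (ρ : M →ₗ[K] M ⊗[K] C)
    (h : ∀ m, (Coalgebra.counit (R := K) (A := C)).lTensor M (ρ m) = m ⊗ₜ[K] (1 : K)) (m : M) :
    TensorProduct.rid K M ((Coalgebra.counit (R := K) (A := C)).lTensor M (ρ m)) = m := by
  rw [h, TensorProduct.rid_tmul, one_smul]

theorem rid_counit_tensor (f : C →ₗ[K] D) (t : V ⊗[K] C) :
    ((TensorProduct.rid K V).toLinearMap ∘ₗ
        (Coalgebra.counit (R := K) (A := C)).lTensor V).rTensor D
      ((TensorProduct.assoc K V C D).symm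
        ((f.lTensor C ∘ₗ Coalgebra.comul (R := K) (A := C)).lTensor V t)) = f.lTensor V t := by
  rw [LinearMap.lTensor_comp_apply, ← lTensor_assoc_symm', ← delta_apply, ← lTensor_rTensor,
    LinearMap.rTensor_comp_apply, rTensor_lTensor_counit_delta, ← LinearMap.rTensor_comp_apply]
  have e : (TensorProduct.rid K V).toLinearMap ∘ₗ (TensorProduct.mk K V K).flip 1 =
      LinearMap.id := LinearMap.ext fun v => by simp
  rw [e, LinearMap.rTensor_id, LinearMap.id_apply]

end ComodAux

/-! ### Right comodules over a coalgebra -/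

/-- A right comodule over the `K`-coalgebra `C`: a `K`-vector space `M` with a coassociative and
counital coaction `ρ : M → M ⊗ C`. -/
structure RightComod (K : Type u) [Field K] (C : Type u) [AddCommGroup C] [Module K C]
    [Coalgebra K C] : Type (u + 1) where
  carrier : Type u
  [addCommGroup : AddCommGroup carrier]
  [module : Module K carrier]
  /-- the coaction -/
  coact : carrier →ₗ[K] carrier ⊗[K] C
  coassoc : ∀ m : carrier,
    TensorProduct.assoc K carrier C C (coact.rTensor C (coact m)) =
      (Coalgebra.comul (R := K) (A := C)).lTensor carrier (coact m)
  lTensor_counit_coact : ∀ m : carrier,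
    (Coalgebra.counit (R := K) (A := C)).lTensor carrier (coact m) = m ⊗ₜ[K] (1 : K)

namespace RightComod

instance (K : Type u) [Field K] (C : Type u) [AddCommGroup C] [Module K C] [Coalgebra K C] :
    CoeSort (RightComod K C) (Type u) := ⟨RightComod.carrier⟩

attribute [instance] RightComod.addCommGroup RightComod.module

variable {K : Type u} [Field K]
variable {C : Type u} [AddCommGroup C] [Module K C] [Coalgebra K C]
variable {D : Type u} [AddCommGroup D] [Module K D] [Coalgebra K D]

/-- Morphisms of right comodules: the `K`-linear maps compatible with the coactions. -/
@[ext]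
structure Hom (M N : RightComod K C) : Type u where
  toLin : M →ₗ[K] N
  comm : ∀ m : M, N.coact (toLin m) = toLin.rTensor C (M.coact m)

/-- The category `𝐌^C` of right `C`-comodules. -/
instance category : Category.{u} (RightComod K C) where
  Hom M N := Hom M N
  id M := { toLin := LinearMap.id, comm := fun m => by simp }
  comp f g :=
    { toLin := g.toLin ∘ₗ f.toLin
      comm := fun m => by
        rw [LinearMap.comp_apply, g.comm, f.comm, LinearMap.rTensor_comp_apply] }

@[ext]
theorem hom_ext {M N : RightComod K C} {f g : M ⟶ N} (h : f.toLin = g.toLin) : f = g :=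
  Hom.ext h

@[simp]
theorem id_toLin (M : RightComod K C) : Hom.toLin (𝟙 M) = LinearMap.id := rfl

@[simp]
theorem comp_toLin {M N P : RightComod K C} (f : M ⟶ N) (g : N ⟶ P) :
    (f ≫ g).toLin = g.toLin ∘ₗ f.toLin := rfl

variable (K C) in
/-- The coalgebra `C` as a right comodule over itself. -/
abbrev regular : RightComod K C where
  carrier := C
  coact := Coalgebra.comul
  coassoc := Coalgebra.coassoc_apply
  lTensor_counit_coact := Coalgebra.lTensor_counit_comul

/-- The corestriction `α^* M = (M, (id ⊗ α) ∘ ρ^M)` of a right `C`-comodule `M = (M, ρ^M)` along a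
morphism of coalgebras `α : C → D`. -/
abbrev corestrictObj (α : C →ₗc[K] D) (M : RightComod K C) : RightComod K D where
  carrier := M.carrier
  addCommGroup := M.addCommGroup
  module := M.module
  coact := α.toLinearMap.lTensor M.carrier ∘ₗ M.coact
  coassoc := ComodAux.corestrict_coassoc α M.coact M.coassoc
  lTensor_counit_coact := ComodAux.corestrict_counit α M.coact M.lTensor_counit_coact

/-- The corestriction functor `α^* : 𝐌^C ⥤ 𝐌^D` of a morphism of coalgebras `α : C → D`; it does
not change the underlying linear maps. -/
abbrev corestrict (α : C →ₗc[K] D) : RightComod K C ⥤ RightComod K D where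
  obj M := corestrictObj α M
  map {M N} f :=
    { toLin := f.toLin
      comm := fun m => (congrArg (α.toLinearMap.lTensor N.carrier) (f.comm m)).trans
        (ComodAux.lTensor_rTensor α.toLinearMap f.toLin (M.coact m)) }

/-- The right comodule `V ⊗ M` with coaction `id_V ⊗ ρ^M`, for a vector space `V` and a right
comodule `M`. -/
abbrev tensorObj (M : RightComod K C) (V : Type u) [AddCommGroup V] [Module K V] :
    RightComod K C where
  carrier := V ⊗[K] M.carrier
  addCommGroup := TensorProduct.addCommGroup
  module := TensorProduct.instModule
  coact := (TensorProduct.assoc K V M.carrier C).symm.toLinearMap ∘ₗ M.coact.lTensor V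
  coassoc := ComodAux.tensor_coassoc V M.coact M.coassoc
  lTensor_counit_coact := ComodAux.tensor_counit V M.coact M.lTensor_counit_coact

/-- The tensor functor `- ⊗ M : Vect ⥤ 𝐌^C` of a right `C`-comodule `M`. -/
abbrev tensorFunctor (M : RightComod K C) : ModuleCat.{u} K ⥤ RightComod K C where
  obj V := tensorObj M V
  map f :=
    { toLin := f.hom.rTensor M.carrier
      comm := ComodAux.tensor_map f.hom M.coact }
  map_id V := hom_ext (LinearMap.rTensor_id M.carrier V)
  map_comp f g := hom_ext (LinearMap.rTensor_comp M.carrier g.hom f.hom)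

/-- The direct sum `M^(Λ)` of copies of a right comodule `M`. -/
def directSum (M : RightComod K C) (Λ : Type u) : RightComod K C where
  carrier := Λ →₀ M.carrier
  addCommGroup := inferInstance
  module := inferInstance
  coact := ComodAux.sumCoact Λ M.coact
  coassoc := ComodAux.sum_coassoc Λ M.coact M.coassoc
  lTensor_counit_coact := ComodAux.sum_counit Λ M.coact M.lTensor_counit_coact

/-- A right comodule `M` is quasi-finite if `- ⊗ M : Vect ⥤ 𝐌^C` has a left adjoint. -/
class IsQuasiFinite (M : RightComod K C) : Prop where
  isRightAdjoint : (tensorFunctor M).IsRightAdjoint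

attribute [instance] IsQuasiFinite.isRightAdjoint

/-- The functor `H_C(M, -) : 𝐌^C ⥤ Vect`, left adjoint to `- ⊗ M`. -/
def cohom (M : RightComod K C) [IsQuasiFinite M] : RightComod K C ⥤ ModuleCat.{u} K :=
  (tensorFunctor M).leftAdjoint

/-- The adjunction between `H_C(M, -)` and `- ⊗ M`. -/
def cohomAdj (M : RightComod K C) [IsQuasiFinite M] : cohom M ⊣ tensorFunctor M :=
  Adjunction.ofIsRightAdjoint _

/-- `C` as a right `D`-comodule, through a morphism of coalgebras `α : C → D`. -/
abbrev overCod (α : C →ₗc[K] D) : RightComod K D := (corestrict α).obj (regular K C)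

/-- The coaction of a right `C`-comodule `W`, as a morphism `α^* W ⟶ W ⊗ C` of right
`D`-comodules. -/
def coactHom (α : C →ₗc[K] D) (W : RightComod K C) :
    (corestrict α).obj W ⟶ (tensorFunctor (overCod α)).obj (ModuleCat.of K W.carrier) where
  toLin := W.coact
  comm := ComodAux.coactHom_comm α.toLinearMap W.coact W.coassoc

/-- The map `V ⊗ C → (V ⊗ C) ⊗ C` is a morphism of right `D`-comodules. -/
def deltaHom (α : C →ₗc[K] D) (V : ModuleCat.{u} K) :
    (tensorFunctor (overCod α)).obj V ⟶
      (tensorFunctor (overCod α)).obj (ModuleCat.of K (V ⊗[K] C)) where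
  toLin := ComodAux.delta K C V
  comm t := by
    have h := (coactHom α (tensorObj (regular K C) V)).comm t
    refine h.trans (congrArg ((ComodAux.delta K C V).rTensor D) ?_)
    exact ComodAux.lTensor_delta α.toLinearMap t

section Shriek

variable (α : C →ₗc[K] D) [IsQuasiFinite (overCod α)]

/-- The unit `N → H_D(C, N) ⊗ C`. -/
def coev (N : RightComod K D) : N.carrier →ₗ[K] ((cohom (overCod α)).obj N) ⊗[K] C :=
  ((cohomAdj (overCod α)).unit.app N).toLin

variable {α}

/-- The linear map `H_D(C, N) → V` corresponding to a morphism `N ⟶ V ⊗ C`. -/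
def lift {N : RightComod K D} {V : ModuleCat.{u} K} (f : N ⟶ (tensorFunctor (overCod α)).obj V) :
    (cohom (overCod α)).obj N →ₗ[K] V :=
  (((cohomAdj (overCod α)).homEquiv N V).symm f).hom

theorem lift_coev {N : RightComod K D} {V : ModuleCat.{u} K}
    (f : N ⟶ (tensorFunctor (overCod α)).obj V) (n : N.carrier) :
    (lift f).rTensor C (coev α N n) = f.toLin n := by
  have h := ((cohomAdj (overCod α)).homEquiv_unit N V
    (((cohomAdj (overCod α)).homEquiv N V).symm f)).symm
  rw [Equiv.apply_symm_apply] at h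
  exact LinearMap.congr_fun (congrArg Hom.toLin h) n

theorem cohom_ext {N : RightComod K D} {V : Type u} [AddCommGroup V] [Module K V]
    {g g' : (cohom (overCod α)).obj N →ₗ[K] V}
    (h : ∀ n, g.rTensor C (coev α N n) = g'.rTensor C (coev α N n)) : g = g' := by
  have h' : ModuleCat.ofHom g = ModuleCat.ofHom g' := by
    apply ((cohomAdj (overCod α)).homEquiv N (ModuleCat.of K V)).injective
    rw [Adjunction.homEquiv_unit, Adjunction.homEquiv_unit]
    exact hom_ext (LinearMap.ext h)
  exact congrArg ModuleCat.Hom.hom h'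

variable (α)

/-- The coaction of `C` on `H_D(C, N)`: the unique linear map `ρ` with
`(ρ ⊗ id) ∘ η = (id ⊗ Δ) ∘ η`, where `η : N → H_D(C, N) ⊗ C` is the unit. -/
def shriekCoact (N : RightComod K D) :
    (cohom (overCod α)).obj N →ₗ[K] ((cohom (overCod α)).obj N) ⊗[K] C :=
  lift ((cohomAdj (overCod α)).unit.app N ≫ deltaHom α ((cohom (overCod α)).obj N))

theorem shriekCoact_coev (N : RightComod K D) (n : N.carrier) :
    (shriekCoact α N).rTensor C (coev α N n) = ComodAux.delta K C _ (coev α N n) :=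
  lift_coev ((cohomAdj (overCod α)).unit.app N ≫ deltaHom α ((cohom (overCod α)).obj N)) n

/-- The right `C`-comodule `α^! N = H_D(C, N)`. -/
def shriekObj (N : RightComod K D) : RightComod K C where
  carrier := (cohom (overCod α)).obj N
  addCommGroup := inferInstance
  module := inferInstance
  coact := shriekCoact α N
  coassoc := by
    refine LinearMap.congr_fun (f := (TensorProduct.assoc K _ C C).toLinearMap ∘ₗ
      (shriekCoact α N).rTensor C ∘ₗ shriekCoact α N)
      (g := (Coalgebra.comul (R := K) (A := C)).lTensor _ ∘ₗ shriekCoact α N)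
      (cohom_ext fun n => ?_)
    rw [LinearMap.rTensor_comp_apply, LinearMap.rTensor_comp_apply, LinearMap.rTensor_comp_apply,
      shriekCoact_coev, ComodAux.delta_natural, shriekCoact_coev, ComodAux.delta_coassoc]
  lTensor_counit_coact := by
    refine LinearMap.congr_fun
      (f := (Coalgebra.counit (R := K) (A := C)).lTensor _ ∘ₗ shriekCoact α N)
      (g := (TensorProduct.mk K _ K).flip 1)
      (cohom_ext fun n => ?_)
    rw [LinearMap.rTensor_comp_apply, shriekCoact_coev, ComodAux.rTensor_lTensor_counit_delta]

/-- The unit `N ⟶ α^* α^! N`. -/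
def shriekUnit (N : RightComod K D) : N ⟶ (corestrict α).obj (shriekObj α N) where
  toLin := ((TensorProduct.rid K _).toLinearMap ∘ₗ
    (Coalgebra.counit (R := K) (A := C)).lTensor _) ∘ₗ coev α N
  comm n := by
    have h := ((cohomAdj (overCod α)).unit.app N).comm n
    change (TensorProduct.assoc K _ C D).symm
      ((α.toLinearMap.lTensor C ∘ₗ Coalgebra.comul (R := K) (A := C)).lTensor _ (coev α N n)) =
        (coev α N).rTensor D (N.coact n) at h
    change α.toLinearMap.lTensor _ (shriekCoact α N (TensorProduct.rid K _
      ((Coalgebra.counit (R := K) (A := C)).lTensor _ (coev α N n)))) =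
      (((TensorProduct.rid K _).toLinearMap ∘ₗ
        (Coalgebra.counit (R := K) (A := C)).lTensor _) ∘ₗ coev α N).rTensor D (N.coact n)
    rw [LinearMap.rTensor_comp_apply, ← h, ComodAux.rid_counit_tensor,
      ComodAux.rid_lTensor_natural, shriekCoact_coev, ComodAux.rid_lTensor_counit_delta]

theorem shriekCoact_unit (N : RightComod K D) (n : N.carrier) :
    shriekCoact α N ((shriekUnit α N).toLin n) = coev α N n := by
  change shriekCoact α N (TensorProduct.rid K _
      ((Coalgebra.counit (R := K) (A := C)).lTensor _ (coev α N n))) = _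
  rw [ComodAux.rid_lTensor_natural, shriekCoact_coev, ComodAux.rid_lTensor_counit_delta]

/-- The morphism `α^! N ⟶ W` of right `C`-comodules corresponding to a morphism `N ⟶ α^* W`. -/
def shriekDesc (N : RightComod K D) (W : RightComod K C) (f : N ⟶ (corestrict α).obj W) :
    shriekObj α N ⟶ W where
  toLin := lift (f ≫ coactHom α W)
  comm := by
    refine LinearMap.congr_fun (f := W.coact ∘ₗ lift (f ≫ coactHom α W))
      (g := (lift (f ≫ coactHom α W)).rTensor C ∘ₗ shriekCoact α N) (cohom_ext fun n => ?_)
    have h : (lift (f ≫ coactHom α W)).rTensor C (coev α N n) = W.coact (f.toLin n) :=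
      lift_coev (f ≫ coactHom α W) n
    rw [LinearMap.rTensor_comp_apply, LinearMap.rTensor_comp_apply, shriekCoact_coev,
      ComodAux.delta_natural]
    erw [h]
    exact ComodAux.rTensor_delta W.coact W.coassoc (f.toLin n)

/-- The bijection `𝐌^C(α^! N, W) ≃ 𝐌^D(N, α^* W)`. -/
def shriekHomEquiv (N : RightComod K D) (W : RightComod K C) :
    (shriekObj α N ⟶ W) ≃ (N ⟶ (corestrict α).obj W) where
  toFun g := shriekUnit α N ≫ (corestrict α).map g
  invFun f := shriekDesc α N W f
  left_inv g := by
    apply hom_ext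
    refine cohom_ext fun n => ?_
    refine (lift_coev ((shriekUnit α N ≫ (corestrict α).map g) ≫ coactHom α W) n).trans ?_
    refine (g.comm ((shriekUnit α N).toLin n)).trans ?_
    exact congrArg (g.toLin.rTensor C) (shriekCoact_unit α N n)
  right_inv f := by
    apply hom_ext
    refine LinearMap.ext fun n => ?_
    refine (ComodAux.rid_lTensor_natural (lift (f ≫ coactHom α W)) Coalgebra.counit
      (coev α N n)).trans ?_
    have h : (lift (f ≫ coactHom α W)).rTensor C (coev α N n) = W.coact (f.toLin n) :=
      lift_coev (f ≫ coactHom α W) n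
    refine (congrArg (fun t => TensorProduct.rid K _
      ((Coalgebra.counit (R := K) (A := C)).lTensor _ t)) h).trans ?_
    exact ComodAux.rid_counit W.coact W.lTensor_counit_coact (f.toLin n)

/-- The functor `α^! = H_D(C, -) : 𝐌^D ⥤ 𝐌^C`. -/
def shriek : RightComod K D ⥤ RightComod K C :=
  Adjunction.leftAdjointOfEquiv (G := corestrict α) (shriekHomEquiv α) fun _ _ _ _ _ => rfl

/-- `α^!` is left adjoint to the corestriction functor `α^*`. -/
def shriekAdj : shriek α ⊣ corestrict α :=
  Adjunction.adjunctionOfEquivLeft (G := corestrict α) (shriekHomEquiv α) fun _ _ _ _ _ => rfl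

end Shriek

/-- A coalgebra morphism `α : C → D` is (right) `Σ`-injective if the direct sum `C^(Λ)` is injective
as a right `D`-comodule, for every index set `Λ`. -/
def IsSigmaInjective (α : C →ₗc[K] D) : Prop :=
  ∀ Λ : Type u, Injective (directSum (overCod α) Λ)

/-- A coalgebra `C` is right semiperfect if the category of right `C`-comodules has enough
projectives. -/
def IsRightSemiperfect (K : Type u) [Field K] (C : Type u) [AddCommGroup C] [Module K C]
    [Coalgebra K C] : Prop :=
  EnoughProjectives (RightComod K C)

end RightComod

/-! ### Trans-comodules over a coalgebra representation -/

section Representation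

variable {K : Type u} [Field K] {X : Type u} [Category.{u} X]

/-- A right trans-comodule `M` over a coalgebra representation `𝒞 : X ⥤ Coalg`: a right
`𝒞_x`-comodule `M_x` for every object `x`, and a morphism `_αM : M_y ⟶ α^* M_x` of right
`𝒞_y`-comodules for every `α : x ⟶ y`, with `_{id}M = id` and `_{βα}M = β^*(_αM) ∘ _βM`. -/
structure TransComod (𝒞 : X ⥤ CoalgCat.{u} K) : Type (u + 1) where
  obj (x : X) : RightComod K (𝒞.obj x)
  map {x y : X} (α : x ⟶ y) :
    obj y ⟶ (RightComod.corestrict (𝒞.map α).toCoalgHom).obj (obj x)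
  map_id (x : X) (m : (obj x).carrier) : (map (𝟙 x)).toLin m = m
  map_comp {x y z : X} (α : x ⟶ y) (β : y ⟶ z) (m : (obj z).carrier) :
    (map (α ≫ β)).toLin m = (map α).toLin ((map β).toLin m)

namespace TransComod

/-- A morphism of trans-comodules: morphisms `η_x : M_x ⟶ N_x` of right `𝒞_x`-comodules compatible
with the structure morphisms. -/
@[ext]
structure Hom {𝒞 : X ⥤ CoalgCat.{u} K} (M N : TransComod 𝒞) : Type u where
  app (x : X) : M.obj x ⟶ N.obj x
  naturality {x y : X} (α : x ⟶ y) :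
    M.map α ≫ (RightComod.corestrict (𝒞.map α).toCoalgHom).map (app x) = app y ≫ N.map α

/-- The category `Com^{tr}-𝒞` of right trans-comodules over `𝒞`. -/
instance category {𝒞 : X ⥤ CoalgCat.{u} K} : Category.{u} (TransComod 𝒞) where
  Hom M N := Hom M N
  id M :=
    { app := fun x => 𝟙 (M.obj x)
      naturality := fun α => by
        rw [CategoryTheory.Functor.map_id, Category.comp_id, Category.id_comp] }
  comp f g :=
    { app := fun x => f.app x ≫ g.app x
      naturality := fun α => by
        rw [CategoryTheory.Functor.map_comp, ← Category.assoc, f.naturality, Category.assoc,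
          g.naturality, Category.assoc] }

end TransComod

/-- A coalgebra representation is quasi-finite if `𝒞_α : 𝒞_x → 𝒞_y` makes `𝒞_x` a quasi-finite right
`𝒞_y`-comodule, for every `α : x ⟶ y`. -/
class IsQuasiFiniteRep (𝒞 : X ⥤ CoalgCat.{u} K) : Prop where
  isQuasiFinite {x y : X} (α : x ⟶ y) :
    RightComod.IsQuasiFinite (RightComod.overCod (𝒞.map α).toCoalgHom)

attribute [instance] IsQuasiFiniteRep.isQuasiFinite

/-- A coalgebra representation is `Σ`-injective if every `𝒞_α : 𝒞_x → 𝒞_y` is `Σ`-injective. -/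
def IsSigmaInjectiveRep (𝒞 : X ⥤ CoalgCat.{u} K) : Prop :=
  ∀ ⦃x y : X⦄ (α : x ⟶ y), RightComod.IsSigmaInjective (𝒞.map α).toCoalgHom

namespace TransComod

variable {𝒞 : X ⥤ CoalgCat.{u} K} [IsQuasiFiniteRep 𝒞]

/-- The morphism `^αM : α^! M_y ⟶ M_x` of right `𝒞_x`-comodules corresponding to
`_αM : M_y ⟶ α^* M_x` under the adjunction between `α^!` and `α^*`. -/
def shriekMap (M : TransComod 𝒞) {x y : X} (α : x ⟶ y) :
    (RightComod.shriek (𝒞.map α).toCoalgHom).obj (M.obj y) ⟶ M.obj x :=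
  ((RightComod.shriekAdj (𝒞.map α).toCoalgHom).homEquiv (M.obj y) (M.obj x)).symm (M.map α)

variable (𝒞) in
/-- A trans-comodule `M` is cartesian if `^αM : α^! M_y ⟶ M_x` is an isomorphism for every
`α : x ⟶ y`. -/
def IsCartesian : ObjectProperty (TransComod 𝒞) :=
  fun M => ∀ ⦃x y : X⦄ (α : x ⟶ y), IsIso (M.shriekMap α)

variable (𝒞) in
/-- The category `Com^{tr}_c-𝒞`: the full subcategory of cartesian trans-comodules. -/
abbrev Cartesian : Type (u + 1) := (IsCartesian 𝒞).FullSubcategory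

end TransComod

end Representation

end

noncomputable section

/-! Exactness is pulled back from families of vector spaces along the forgetful functor
`Cartesian.toFamily`. This functor is conservative, because a bijective comodule map has a comodule
inverse. Kernels and colimits of trans-comodules are computed on the underlying vector spaces at
each object, so the point is that cartesian trans-comodules are closed under both.

For colimits this is formal: `α^!` is a left adjoint, so the map `^αM` of a colimit is a colimit of
isomorphisms (`isCartesian_colimitObj`). For kernels the exactness of `α^!` is needed, and this is
where `Σ`-injectivity enters. The linear dual of `H_D(C, N)` is `Hom_D(N, K ⊗ C)`, which is exact in
`N` because `C` is an injective `D`-comodule, and linear forms detect exactness of vector spaces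
(`IsSigmaInjective.exact`, `isCartesian_ker`). Hence `Cartesian.toFamily` preserves kernels and
colimits and reflects isomorphisms, which gives both the abelian structure and the exactness of
filtered colimits.

The separator comes from a Löwenheim–Skolem argument (`exists_cartesian_sub`). An element of a
comodule has a coaction involving finitely many elements, and an element of `α^! N` comes from any
subcomodule containing a suitable finite set. Starting from one element of a cartesian `M` and
closing up under these finite choices and the structure maps gives a cartesian subobject spanned by
words in an alphabet depending only on `X`. Such subobjects have presentations forming a set
(`QuotData`), and the coproduct of one representative for each presentation is a separator. -/

/-! ### Abelian categories from conservative exact functors -/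

namespace CategoryTheory

open Limits

/-- A preadditive category with finite products, kernels and cokernels is abelian if it has a
conservative functor to an abelian category which preserves kernels and cokernels. -/
@[reducible]
def abelianOfReflectsIsomorphisms {A : Type*} [Category* A] [Preadditive A] [HasFiniteProducts A]
    [HasKernels A] [HasCokernels A] {B : Type*} [Category* B] [Abelian B] (U : A ⥤ B)
    [U.PreservesZeroMorphisms] [∀ {M N : A} (f : M ⟶ N), PreservesLimit (parallelPair f 0) U]
    [∀ {M N : A} (f : M ⟶ N), PreservesColimit (parallelPair f 0) U]
    [U.ReflectsIsomorphisms] : Abelian A := by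
  have : ∀ {M N : A} (f : M ⟶ N), IsIso (Abelian.coimageImageComparison f) := by
    intro M N f
    -- Since `U` preserves kernels and cokernels, it carries the coimage-image comparison of `f` to
    -- that of `U.map f`, which is invertible because `B` is abelian.
    have : IsIso (U.map (Abelian.coimageImageComparison f)) := by
      rw [Arrow.isIso_iff_isIso_of_isIso (Abelian.PreservesCoimageImageComparison.iso U f).hom]
      infer_instance
    exact isIso_of_reflects_iso _ U
  exact Abelian.ofCoimageImageComparisonIsIso

end CategoryTheory

/-! ### Vector spaces -/

namespace ComodAux

variable {K : Type u} [Field K]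
variable {V : Type u} [AddCommGroup V] [Module K V]
variable {W : Type u} [AddCommGroup W] [Module K W]
variable {C : Type u} [AddCommGroup C] [Module K C]

theorem rTensor_injective (i : V →ₗ[K] W) (hi : Function.Injective i) :
    Function.Injective (i.rTensor C) :=
  Module.Flat.rTensor_preserves_injective_linearMap i hi

/-- Contraction of the second tensor factor with a linear form. -/
def contract (φ : C →ₗ[K] K) : V ⊗[K] C →ₗ[K] V :=
  (TensorProduct.rid K V).toLinearMap ∘ₗ φ.lTensor V

theorem contract_rTensor (φ : C →ₗ[K] K) (g : V →ₗ[K] W) (t : V ⊗[K] C) :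
    contract φ (g.rTensor C t) = g (contract φ t) :=
  (rid_lTensor_natural g φ t).symm

/-- In terms of a basis of `C`, the coordinates of `t` are its contractions with the coordinate
forms. -/
theorem eq_zero_of_contract {t : V ⊗[K] C} (h : ∀ φ : C →ₗ[K] K, contract φ t = 0) : t = 0 := by
  classical
  let b := Module.Basis.ofVectorSpace K C
  apply (TensorProduct.equivFinsuppOfBasisRight (M := V) b).injective
  rw [map_zero]
  ext i
  rw [TensorProduct.equivFinsuppOfBasisRight_apply]
  exact h (b.coord i)

end ComodAux

namespace RightComod

variable {K : Type u} [Field K]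
variable {C : Type u} [AddCommGroup C] [Module K C] [Coalgebra K C]
variable {D : Type u} [AddCommGroup D] [Module K D] [Coalgebra K D]

/-! ### The preadditive category of comodules -/

section Preadditive

variable {M N : RightComod K C}

instance : Zero (M ⟶ N) := ⟨{ toLin := 0, comm := fun m => by simp }⟩

instance : Add (M ⟶ N) :=
  ⟨fun f g =>
    { toLin := f.toLin + g.toLin
      comm := fun m => by
        rw [LinearMap.add_apply, map_add, f.comm, g.comm, LinearMap.rTensor_add,
          LinearMap.add_apply] }⟩

instance : Neg (M ⟶ N) :=
  ⟨fun f =>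
    { toLin := -f.toLin
      comm := fun m => by
        rw [LinearMap.neg_apply, map_neg, f.comm, LinearMap.rTensor_neg, LinearMap.neg_apply] }⟩

@[simp]
theorem zero_toLin : (0 : M ⟶ N).toLin = 0 := rfl

instance : AddCommGroup (M ⟶ N) where
  add_assoc _ _ _ := hom_ext (add_assoc _ _ _)
  zero_add _ := hom_ext (zero_add _)
  add_zero _ := hom_ext (add_zero _)
  neg_add_cancel _ := hom_ext (neg_add_cancel _)
  add_comm _ _ := hom_ext (add_comm _ _)
  nsmul := nsmulRec
  zsmul := zsmulRec

instance : Preadditive (RightComod K C) where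
  add_comp _ _ _ _ _ _ := hom_ext (LinearMap.comp_add _ _ _)
  comp_add _ _ _ _ _ _ := hom_ext (LinearMap.add_comp _ _ _)

instance (α : C →ₗc[K] D) : (corestrict α).Additive where
  map_add := rfl

end Preadditive

/-! ### Isomorphisms -/

/-- Colinearity of the inverse is automatic: it may be tested on elements `f m`, where it follows
from colinearity of `f`. -/
theorem isIso_of_bijective {M N : RightComod K C} (f : M ⟶ N)
    (hf : Function.Bijective f.toLin) : IsIso f := by
  let e := LinearEquiv.ofBijective f.toLin hf
  refine ⟨{ toLin := e.symm.toLinearMap, comm := fun n => ?_ }, hom_ext ?_, hom_ext ?_⟩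
  · obtain ⟨m, rfl⟩ := hf.2 n
    have h : e.symm.toLinearMap ∘ₗ f.toLin = LinearMap.id :=
      LinearMap.ext fun x => e.symm_apply_apply x
    have h' : e.symm.toLinearMap (f.toLin m) = m := LinearMap.congr_fun h m
    rw [f.comm, ← LinearMap.rTensor_comp_apply, h, LinearMap.rTensor_id, h', LinearMap.id_apply]
  · exact LinearMap.ext fun x => e.symm_apply_apply x
  · exact LinearMap.ext fun x => e.apply_symm_apply x

theorem bijective_of_isIso {M N : RightComod K C} (f : M ⟶ N) [IsIso f] :
    Function.Bijective f.toLin :=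
  Function.bijective_iff_has_inverse.2 ⟨(inv f).toLin,
    fun x => LinearMap.congr_fun (congrArg Hom.toLin (IsIso.hom_inv_id f)) x,
    fun x => LinearMap.congr_fun (congrArg Hom.toLin (IsIso.inv_hom_id f)) x⟩

/-! ### Subcomodules -/

section Sub

variable (M : RightComod K C) (p : Submodule K M.carrier)

/-- A subspace `p` of a comodule is stable if the coaction maps it into `p ⊗ C`. -/
def IsStable : Prop := ∀ m ∈ p, M.coact m ∈ LinearMap.range (p.subtype.rTensor C)

variable {M p}

/-- The restriction of the coaction to a stable subspace. -/
def subCoact (h : IsStable M p) : p →ₗ[K] p ⊗[K] C :=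
  (LinearEquiv.ofInjective (p.subtype.rTensor C)
      (ComodAux.rTensor_injective _ p.injective_subtype)).symm.toLinearMap ∘ₗ
    (M.coact ∘ₗ p.subtype).codRestrict _ fun m => h m m.2

theorem subtype_subCoact (h : IsStable M p) (m : p) :
    p.subtype.rTensor C (subCoact h m) = M.coact m := by
  have e := LinearEquiv.apply_symm_apply (LinearEquiv.ofInjective (p.subtype.rTensor C)
      (ComodAux.rTensor_injective _ p.injective_subtype))
      ((M.coact ∘ₗ p.subtype).codRestrict _ (fun m => h m m.2) m)
  exact congrArg Subtype.val e

/-- The subcomodule on a stable subspace. -/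
abbrev sub (h : IsStable M p) : RightComod K C where
  carrier := p
  addCommGroup := inferInstance
  module := inferInstance
  coact := subCoact h
  coassoc m := by
    -- The axioms are inherited from `M`: tensoring the inclusion of `p` over a field keeps it
    -- injective, so they may be checked after inclusion.
    apply ComodAux.rTensor_injective p.subtype p.injective_subtype
    have e : p.subtype.rTensor C ∘ₗ subCoact h = M.coact ∘ₗ p.subtype :=
      LinearMap.ext fun m => subtype_subCoact h m
    rw [← ComodAux.assoc_rTensor_rTensor, ← LinearMap.rTensor_comp_apply, e,
      LinearMap.rTensor_comp_apply, subtype_subCoact, M.coassoc, ← ComodAux.lTensor_rTensor,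
      subtype_subCoact]
  lTensor_counit_coact m := by
    apply ComodAux.rTensor_injective p.subtype p.injective_subtype
    rw [← ComodAux.lTensor_rTensor, subtype_subCoact, M.lTensor_counit_coact]
    rfl

/-- The inclusion of a subcomodule. -/
def subι (h : IsStable M p) : sub h ⟶ M where
  toLin := p.subtype
  comm m := (subtype_subCoact h m).symm

/-- A morphism with values in a stable subspace factors through the subcomodule. -/
def subLift (h : IsStable M p) {N : RightComod K C} (f : N ⟶ M) (hf : ∀ n, f.toLin n ∈ p) :
    N ⟶ sub h where
  toLin := f.toLin.codRestrict p hf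
  comm n := by
    apply ComodAux.rTensor_injective p.subtype p.injective_subtype
    rw [← LinearMap.rTensor_comp_apply, LinearMap.subtype_comp_codRestrict, ← f.comm]
    exact subtype_subCoact h _

theorem isStable_range {N : RightComod K C} (f : N ⟶ M) : IsStable M (LinearMap.range f.toLin) := by
  rintro _ ⟨n, rfl⟩
  refine ⟨f.toLin.rangeRestrict.rTensor C (N.coact n), ?_⟩
  rw [← LinearMap.rTensor_comp_apply, f.comm]
  rfl

/-- By flatness the kernel of `f ⊗ C` is `ker f ⊗ C`, and `f ⊗ C` kills the coaction of any element
of `ker f`. -/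
theorem isStable_ker {N : RightComod K C} (f : M ⟶ N) : IsStable M (LinearMap.ker f.toLin) := by
  intro m hm
  have h : Function.Exact (LinearMap.ker f.toLin).subtype f.toLin :=
    LinearMap.exact_subtype_ker_map f.toLin
  have h' := Module.Flat.rTensor_exact C h
  refine (h' _).1 ?_
  rw [← f.comm, LinearMap.mem_ker.1 hm, map_zero]

end Sub

/-- If `g : N ⟶ I` kills the kernel of `f : N ⟶ N'` and `I` is injective, then `g` factors
through `f`. -/
theorem exists_factor {N N' I : RightComod K C} [Injective I] (f : N ⟶ N') (g : N ⟶ I)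
    (h : ∀ n, f.toLin n = 0 → g.toLin n = 0) : ∃ g' : N' ⟶ I, f ≫ g' = g := by
  -- `f` is split into a surjection onto its image and an inclusion: `g` descends to the image since
  -- it kills `ker f`, and injectivity of `I` then extends it to `N'`.
  let r : N ⟶ sub (isStable_range f) := subLift _ f fun n => ⟨n, rfl⟩
  have hr : Function.Surjective f.toLin.rangeRestrict := f.toLin.surjective_rangeRestrict
  have hk : LinearMap.ker f.toLin.rangeRestrict ≤ LinearMap.ker g.toLin := fun n hn =>
    h n (congrArg Subtype.val (LinearMap.mem_ker.1 hn))
  let q : LinearMap.range f.toLin →ₗ[K] I.carrier :=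
    (LinearMap.ker f.toLin.rangeRestrict).liftQ g.toLin hk ∘ₗ
      (f.toLin.rangeRestrict.quotKerEquivOfSurjective hr).symm.toLinearMap
  have hq : q ∘ₗ f.toLin.rangeRestrict = g.toLin := by
    ext n
    have e : (f.toLin.rangeRestrict.quotKerEquivOfSurjective hr).symm (f.toLin.rangeRestrict n) =
        Submodule.Quotient.mk n := by
      rw [LinearEquiv.symm_apply_eq]
      rfl
    change (LinearMap.ker f.toLin.rangeRestrict).liftQ g.toLin hk
      ((f.toLin.rangeRestrict.quotKerEquivOfSurjective hr).symm (f.toLin.rangeRestrict n)) = _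
    rw [e]
    rfl
  let q' : sub (isStable_range f) ⟶ I :=
    { toLin := q
      comm := fun m => by
        obtain ⟨n, rfl⟩ := hr m
        have e1 : q (f.toLin.rangeRestrict n) = g.toLin n := LinearMap.congr_fun hq n
        have e2 := r.comm n
        have e3 : (sub (isStable_range f)).coact (f.toLin.rangeRestrict n) =
          f.toLin.rangeRestrict.rTensor C (N.coact n) := e2
        rw [e1, e3, g.comm, ← LinearMap.rTensor_comp_apply, hq] }
  have hm : Mono (subι (isStable_range f)) := by
    refine ⟨fun a b hab => hom_ext (LinearMap.ext fun x => Subtype.ext ?_)⟩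
    exact LinearMap.congr_fun (congrArg Hom.toLin hab) x
  -- Here `q'` is `g` descended to the image of `f`, now known to be colinear.
  refine ⟨Injective.factorThru q' (subι (isStable_range f)), ?_⟩
  have e := Injective.comp_factorThru q' (subι (isStable_range f))
  exact (congrArg (r ≫ ·) e).trans (hom_ext hq)

end RightComod

namespace RightComod

variable {K : Type u} [Field K]
variable {C : Type u} [AddCommGroup C] [Module K C] [Coalgebra K C]
variable {D : Type u} [AddCommGroup D] [Module K D] [Coalgebra K D]

/-! ### Exactness of the functor `α^!` -/

section Exactness

variable {α : C →ₗc[K] D}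

/-- A one-element index set suffices, as `K ⊗ C` is isomorphic to `C^(PUnit)`. The tensor form is
the one that matters, since morphisms `N ⟶ K ⊗ C` are the linear forms on `H_D(C, N)`. -/
theorem IsSigmaInjective.injective_tensor (hα : IsSigmaInjective α) :
    Injective ((tensorFunctor (overCod α)).obj (ModuleCat.of K K)) := by
  have := hα PUnit
  let e : K ⊗[K] C ≃ₗ[K] (PUnit.{u + 1} →₀ C) :=
    (TensorProduct.lid K C).trans (Finsupp.uniqueLinearEquiv K C PUnit.unit).symm
  have he (k : K) (c : C) : e (k ⊗ₜ c) = Finsupp.single PUnit.unit (k • c) := by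
    apply (Finsupp.uniqueLinearEquiv K C PUnit.unit).injective
    simp [e]
  let f : (tensorFunctor (overCod α)).obj (ModuleCat.of K K) ⟶ directSum (overCod α) PUnit :=
    { toLin := e.toLinearMap
      comm := fun t => by
        refine LinearMap.congr_fun
          (f := (directSum (overCod α) PUnit).coact ∘ₗ e.toLinearMap)
          (g := e.toLinearMap.rTensor D ∘ₗ
            (tensorObj (overCod α) K).coact) (TensorProduct.ext' fun k c => ?_) t
        have h1 (s : C ⊗[K] D) : (Finsupp.lsingle (R := K) PUnit.unit).rTensor D (k • s) =
            e.toLinearMap.rTensor D ((TensorProduct.assoc K K C D).symm (k ⊗ₜ s)) := by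
          induction s using TensorProduct.induction_on with
          | zero => simp
          | add x y hx hy => simp only [smul_add, map_add, TensorProduct.tmul_add, hx, hy]
          | tmul x y =>
            rw [TensorProduct.smul_tmul', LinearMap.rTensor_tmul, TensorProduct.assoc_symm_tmul,
              LinearMap.rTensor_tmul]
            exact congrArg (· ⊗ₜ[K] y) (he k x).symm
        change ComodAux.sumCoact PUnit (overCod α).coact (e (k ⊗ₜ c)) = _
        rw [he, ComodAux.sumCoact_single, map_smul]
        exact h1 _ }
  have : IsIso f := isIso_of_bijective f e.bijective
  exact Injective.of_iso (asIso f).symm ‹_›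

variable [IsQuasiFinite (overCod α)]

theorem shriekDesc_coev {N : RightComod K D} {W : RightComod K C}
    (f : N ⟶ (corestrict α).obj W) (n : N.carrier) :
    (shriekDesc α N W f).toLin.rTensor C (coev α N n) = W.coact (f.toLin n) :=
  lift_coev (f ≫ coactHom α W) n

variable (α) in
/-- The linear map underlying `α^! f`. -/
def shriekLin {N N' : RightComod K D} (f : N ⟶ N') :
    (cohom (overCod α)).obj N →ₗ[K] (cohom (overCod α)).obj N' :=
  ((shriek α).map f).toLin

/-- Naturality of the unit `N → H_D(C, N) ⊗ C`; by `cohom_ext` it determines `α^! f`. -/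
theorem shriekLin_coev {N N' : RightComod K D} (f : N ⟶ N') (n : N.carrier) :
    (shriekLin α f).rTensor C (coev α N n) = coev α N' (f.toLin n) :=
  (shriekDesc_coev (f ≫ shriekHomEquiv α N' _ (𝟙 _)) n).trans (shriekCoact_unit α N' (f.toLin n))

/-- The quotient map by the span becomes zero after composition with the unit, so it is zero by
uniqueness in the universal property. Each generator involves a single element of `N`, which is the
source of the finiteness of `α^!`. -/
theorem span_contract_coev (N : RightComod K D) :
    Submodule.span K {h | ∃ (φ : C →ₗ[K] K) (n : N.carrier),
      h = ComodAux.contract φ (coev α N n)} = ⊤ := by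
  set S := Submodule.span K {h | ∃ (φ : C →ₗ[K] K) (n : N.carrier),
      h = ComodAux.contract φ (coev α N n)} with hS
  have h : S.mkQ = 0 := cohom_ext fun n => by
    rw [LinearMap.rTensor_zero, LinearMap.zero_apply]
    refine ComodAux.eq_zero_of_contract fun φ => ?_
    rw [ComodAux.contract_rTensor, Submodule.mkQ_apply, Submodule.Quotient.mk_eq_zero]
    exact Submodule.subset_span ⟨φ, n, rfl⟩
  rw [← Submodule.ker_mkQ S, h, LinearMap.ker_zero]

/-- Every element of `α^! N` comes from every subcomodule of `N` containing some finite set. -/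
theorem exists_finite_support (N : RightComod K D) (h : (cohom (overCod α)).obj N) :
    ∃ T : Set N.carrier, T.Finite ∧ ∀ (p : Submodule K N.carrier) (hp : IsStable N p), T ⊆ p →
      h ∈ LinearMap.range (shriekLin α (subι hp)) := by
  have hh : h ∈ Submodule.span K {h | ∃ (φ : C →ₗ[K] K) (n : N.carrier),
      h = ComodAux.contract φ (coev α N n)} := by
    rw [span_contract_coev]
    trivial
  induction hh using Submodule.span_induction with
  | mem x hx =>
    obtain ⟨φ, n, rfl⟩ := hx
    refine ⟨{n}, Set.finite_singleton n, fun p hp hT => ?_⟩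
    have hn : n ∈ p := hT rfl
    refine ⟨ComodAux.contract φ (coev α (sub hp) ⟨n, hn⟩), ?_⟩
    refine (ComodAux.contract_rTensor φ (shriekLin α (subι hp)) _).symm.trans ?_
    exact congrArg (ComodAux.contract φ) (shriekLin_coev (subι hp) ⟨n, hn⟩)
  | zero => exact ⟨∅, Set.finite_empty, fun p hp _ => Submodule.zero_mem _⟩
  | add x y _ _ hx hy =>
    obtain ⟨S, hS, hS'⟩ := hx
    obtain ⟨T, hT, hT'⟩ := hy
    exact ⟨S ∪ T, hS.union hT, fun p hp h => Submodule.add_mem _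
      (hS' p hp (Set.subset_union_left.trans h)) (hT' p hp (Set.subset_union_right.trans h))⟩
  | smul a x _ hx =>
    obtain ⟨S, hS, hS'⟩ := hx
    exact ⟨S, hS, fun p hp h => Submodule.smul_mem _ a (hS' p hp h)⟩

/-- If `α` is `Σ`-injective, then `α^!` is exact. -/
theorem IsSigmaInjective.exact (hα : IsSigmaInjective α) {P N N' : RightComod K D} (i : P ⟶ N)
    (f : N ⟶ N') (hif : ∀ n, f.toLin n = 0 → ∃ p, i.toLin p = n) (h : (cohom (overCod α)).obj N)
    (hh : (shriekLin α f) h = 0) : ∃ h', (shriekLin α i) h' = h := by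
  have := hα.injective_tensor
  by_contra hne
  -- If `h` were outside the image, some linear form `φ` would vanish on the image but not at `h`.
  obtain ⟨φ, hφ, hi⟩ := Submodule.exists_le_ker_of_notMem
    (p := LinearMap.range (shriekLin α i)) (v := h) hne
  have hφi : φ ∘ₗ (shriekLin α i) = 0 :=
    LinearMap.ext fun x => hi ⟨x, rfl⟩
  -- `g` corresponds to `φ` under the adjunction. It kills the image of `i`, hence `ker f`, so it
  -- factors through `f` by injectivity of `K ⊗ C`.
  let g : N ⟶ (tensorFunctor (overCod α)).obj (ModuleCat.of K K) :=
    (cohomAdj (overCod α)).unit.app N ≫ (tensorFunctor (overCod α)).map (ModuleCat.ofHom φ)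
  have hg (n : N.carrier) : g.toLin n = φ.rTensor C (coev α N n) := rfl
  obtain ⟨g', hg'⟩ := exists_factor f g fun n hn => by
    obtain ⟨p, rfl⟩ := hif n hn
    rw [hg, ← shriekLin_coev, ← LinearMap.rTensor_comp_apply, hφi, LinearMap.rTensor_zero,
      LinearMap.zero_apply]
  -- Transposing the factorization back shows that `φ` factors through `α^! f`, which kills `h`: a
  -- contradiction.
  have e : φ = lift g' ∘ₗ (shriekLin α f) := cohom_ext fun n => by
    rw [← hg, ← hg', LinearMap.rTensor_comp_apply, shriekLin_coev, lift_coev]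
    rfl
  apply hφ
  rw [e, LinearMap.comp_apply, hh, map_zero]

/-- If `α` is `Σ`-injective, then `α^!` preserves injective morphisms. -/
theorem IsSigmaInjective.shriekLin_injective (hα : IsSigmaInjective α) {N N' : RightComod K D}
    (f : N ⟶ N') (hf : Function.Injective f.toLin) :
    Function.Injective (shriekLin α f) := by
  refine (injective_iff_map_eq_zero _).2 fun h hh => ?_
  -- As `ker f` is zero, exactness applies with the zero morphism in front, and `α^!` sends that to
  -- zero.
  obtain ⟨h', rfl⟩ := hα.exact (0 : N ⟶ N) f
    (fun n hn => ⟨0, (hf (hn.trans (map_zero _).symm)).symm ▸ map_zero _⟩) h hh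
  have e : shriekLin α (0 : N ⟶ N) = 0 := cohom_ext fun n => by
    rw [shriekLin_coev, zero_toLin, LinearMap.zero_apply, map_zero, LinearMap.rTensor_zero, LinearMap.zero_apply]
  rw [e, LinearMap.zero_apply]

end Exactness

/-! ### Colimits of comodules -/

section Colimits

open Limits

variable (K C) in
/-- The functor from comodules to the underlying vector spaces. -/
@[simps]
def forgetMod : RightComod K C ⥤ ModuleCat.{u} K where
  obj M := ModuleCat.of K M.carrier
  map f := ModuleCat.ofHom f.toLin

instance : (forgetMod K C).ReflectsIsomorphisms where
  reflects f hf := by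
    apply isIso_of_bijective
    exact ConcreteCategory.bijective_of_isIso ((forgetMod K C).map f)

variable {J : Type u} [SmallCategory J] (G : J ⥤ RightComod K C)

/-- The map from a term of a diagram to the colimit of the underlying vector spaces. -/
def colimitι (j : J) : (G.obj j).carrier →ₗ[K] (colimit (G ⋙ forgetMod K C) : ModuleCat.{u} K) :=
  (colimit.ι (G ⋙ forgetMod K C) j).hom

variable {G} in
theorem colimit_lin_ext {V : Type u} [AddCommGroup V] [Module K V]
    {f g : (colimit (G ⋙ forgetMod K C) : ModuleCat.{u} K) →ₗ[K] V}
    (h : ∀ j m, f (colimitι G j m) = g (colimitι G j m)) : f = g := by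
  have : ModuleCat.ofHom f = ModuleCat.ofHom g :=
    colimit.hom_ext fun j => ModuleCat.hom_ext (LinearMap.ext (h j))
  exact congrArg ModuleCat.Hom.hom this

variable {G} in
/-- The linear map from the colimit of the underlying vector spaces defined by a compatible
family. -/
def colimitDesc {V : Type u} [AddCommGroup V] [Module K V]
    (f : ∀ j, (G.obj j).carrier →ₗ[K] V)
    (hf : ∀ (i j : J) (a : i ⟶ j) (m : (G.obj i).carrier), f j ((G.map a).toLin m) = f i m) :
    (colimit (G ⋙ forgetMod K C) : ModuleCat.{u} K) →ₗ[K] V :=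
  (colimit.desc (G ⋙ forgetMod K C)
    { pt := ModuleCat.of K V
      ι :=
        { app := fun j => ModuleCat.ofHom (f j)
          naturality := fun _ _ a => ModuleCat.hom_ext (LinearMap.ext (hf _ _ a)) } }).hom

theorem colimitDesc_ι {V : Type u} [AddCommGroup V] [Module K V]
    (f : ∀ j, (G.obj j).carrier →ₗ[K] V)
    (hf : ∀ (i j : J) (a : i ⟶ j) (m : (G.obj i).carrier), f j ((G.map a).toLin m) = f i m)
    (j : J) (m : (G.obj j).carrier) : colimitDesc f hf (colimitι G j m) = f j m :=
  LinearMap.congr_fun (congrArg ModuleCat.Hom.hom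
    (colimit.ι_desc (F := G ⋙ forgetMod K C)
      { pt := ModuleCat.of K V
        ι :=
          { app := fun j => ModuleCat.ofHom (f j)
            naturality := fun _ _ a => ModuleCat.hom_ext (LinearMap.ext (hf _ _ a)) } } j)) m

theorem colimitι_map {i j : J} (a : i ⟶ j) (m : (G.obj i).carrier) :
    colimitι G j ((G.map a).toLin m) = colimitι G i m :=
  LinearMap.congr_fun (congrArg ModuleCat.Hom.hom (colimit.w (G ⋙ forgetMod K C) a)) m

/-- The coaction on the colimit of the underlying vector spaces. -/
def colimitCoact : (colimit (G ⋙ forgetMod K C) : ModuleCat.{u} K) →ₗ[K]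
    (colimit (G ⋙ forgetMod K C) : ModuleCat.{u} K) ⊗[K] C :=
  colimitDesc (fun j => (colimitι G j).rTensor C ∘ₗ (G.obj j).coact) fun i j a m => by
    have e : colimitι G j ∘ₗ (G.map a).toLin = colimitι G i :=
      LinearMap.ext fun m => colimitι_map G a m
    rw [LinearMap.comp_apply, (G.map a).comm, ← LinearMap.rTensor_comp_apply, e]
    rfl

theorem colimitCoact_ι (j : J) (m : (G.obj j).carrier) :
    colimitCoact G (colimitι G j m) = (colimitι G j).rTensor C ((G.obj j).coact m) := by
  rw [colimitCoact, colimitDesc_ι, LinearMap.comp_apply]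

/-- The colimit of a diagram of comodules. -/
abbrev colimitObj : RightComod K C where
  carrier := (colimit (G ⋙ forgetMod K C) : ModuleCat.{u} K)
  addCommGroup := inferInstance
  module := inferInstance
  coact := colimitCoact G
  coassoc := by
    refine LinearMap.congr_fun (f := (TensorProduct.assoc K _ C C).toLinearMap ∘ₗ
      (colimitCoact G).rTensor C ∘ₗ colimitCoact G)
      (g := (Coalgebra.comul (R := K) (A := C)).lTensor _ ∘ₗ colimitCoact G)
      (colimit_lin_ext fun j m => ?_)
    have e : colimitCoact G ∘ₗ colimitι G j = (colimitι G j).rTensor C ∘ₗ (G.obj j).coact :=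
      LinearMap.ext fun m => colimitCoact_ι G j m
    change TensorProduct.assoc K _ C C ((colimitCoact G).rTensor C
      (colimitCoact G (colimitι G j m))) =
        (Coalgebra.comul (R := K) (A := C)).lTensor _ (colimitCoact G (colimitι G j m))
    rw [colimitCoact_ι, ← LinearMap.rTensor_comp_apply, e, LinearMap.rTensor_comp_apply,
      ComodAux.assoc_rTensor_rTensor, (G.obj j).coassoc, ComodAux.lTensor_rTensor]
  lTensor_counit_coact := by
    refine LinearMap.congr_fun
      (f := (Coalgebra.counit (R := K) (A := C)).lTensor _ ∘ₗ colimitCoact G)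
      (g := (TensorProduct.mk K _ K).flip 1) (colimit_lin_ext fun j m => ?_)
    rw [LinearMap.comp_apply, colimitCoact_ι, ComodAux.lTensor_rTensor,
      (G.obj j).lTensor_counit_coact]
    rfl

/-- The colimit cocone of a diagram of comodules. -/
abbrev colimitCocone : Cocone G where
  pt := colimitObj G
  ι :=
    { app := fun j => { toLin := colimitι G j, comm := colimitCoact_ι G j }
      naturality := fun _ _ a => hom_ext (LinearMap.ext fun m => colimitι_map G a m) }

/-- The colimit cocone of comodules is a colimit on underlying vector spaces. -/
def isColimitForgetColimitCocone : IsColimit ((forgetMod K C).mapCocone (colimitCocone G)) :=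
  (colimit.isColimit (G ⋙ forgetMod K C)).ofIsoColimit (Cocone.ext (Iso.refl _))

variable {G} in
/-- The linear map from the colimit given by a cocone of comodules. -/
def colimitDescCocone (s : Cocone G) :
    (colimit (G ⋙ forgetMod K C) : ModuleCat.{u} K) →ₗ[K] s.pt.carrier :=
  colimitDesc (V := s.pt.carrier) (fun j => (s.ι.app j).toLin) fun _ _ a m =>
    LinearMap.congr_fun (congrArg Hom.toLin (s.w a)) m

variable {G} in
theorem colimitDescCocone_ι (s : Cocone G) (j : J) (m : (G.obj j).carrier) :
    colimitDescCocone s (colimitι G j m) = (s.ι.app j).toLin m :=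
  colimitDesc_ι G (V := s.pt.carrier) _ _ j m

/-- The colimit cocone of comodules is a colimit. -/
def isColimitColimitCocone : IsColimit (colimitCocone G) where
  desc s :=
    { toLin := colimitDescCocone s
      comm := by
        set d := colimitDescCocone s with hd
        refine LinearMap.congr_fun (f := s.pt.coact ∘ₗ d) (g := d.rTensor C ∘ₗ colimitCoact G)
          (colimit_lin_ext fun j m => ?_)
        have e : d ∘ₗ colimitι G j = (s.ι.app j).toLin :=
          LinearMap.ext fun m => colimitDescCocone_ι s j m
        rw [LinearMap.comp_apply, LinearMap.comp_apply, colimitCoact_ι,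
          ← LinearMap.rTensor_comp_apply, e, ← (s.ι.app j).comm, ← e]
        rfl }
  fac s j := hom_ext (LinearMap.ext fun m => colimitDescCocone_ι s j m)
  uniq s f hf := hom_ext (colimit_lin_ext fun j m =>
    (LinearMap.congr_fun (congrArg Hom.toLin (hf j)) m).trans (colimitDescCocone_ι s j m).symm)

end Colimits

end RightComod

namespace TransComod

open Limits RightComod

variable {K : Type u} [Field K] {X : Type u} [Category.{u} X] {𝒞 : X ⥤ CoalgCat.{u} K}

@[ext]
theorem hom_ext {M N : TransComod 𝒞} {f g : M ⟶ N} (h : ∀ x, f.app x = g.app x) : f = g :=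
  Hom.ext (funext h)

@[simp]
theorem id_app (M : TransComod 𝒞) (x : X) : Hom.app (𝟙 M) x = 𝟙 (M.obj x) := rfl

@[simp]
theorem comp_app {M N P : TransComod 𝒞} (f : M ⟶ N) (g : N ⟶ P) (x : X) :
    (f ≫ g).app x = f.app x ≫ g.app x := rfl

/-! ### The preadditive category of trans-comodules -/

section Preadditive

variable {M N : TransComod 𝒞}

instance : Zero (M ⟶ N) :=
  ⟨{ app := fun _ => 0
     naturality := fun α => by rw [Functor.map_zero, comp_zero, zero_comp] }⟩

instance : Add (M ⟶ N) :=
  ⟨fun f g =>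
    { app := fun x => f.app x + g.app x
      naturality := fun α => by
        rw [Functor.map_add, Preadditive.comp_add, Preadditive.add_comp, f.naturality,
          g.naturality] }⟩

instance : Neg (M ⟶ N) :=
  ⟨fun f =>
    { app := fun x => -f.app x
      naturality := fun α => by
        rw [Functor.map_neg, Preadditive.comp_neg, Preadditive.neg_comp, f.naturality] }⟩

instance : AddCommGroup (M ⟶ N) where
  add_assoc _ _ _ := hom_ext fun _ => add_assoc _ _ _
  zero_add _ := hom_ext fun _ => zero_add _
  add_zero _ := hom_ext fun _ => add_zero _
  neg_add_cancel _ := hom_ext fun _ => neg_add_cancel _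
  add_comm _ _ := hom_ext fun _ => add_comm _ _
  nsmul := nsmulRec
  zsmul := zsmulRec

instance : Preadditive (TransComod 𝒞) where
  add_comp _ _ _ _ _ _ := hom_ext fun _ => Preadditive.add_comp _ _ _ _ _ _
  comp_add _ _ _ _ _ _ := hom_ext fun _ => Preadditive.comp_add _ _ _ _ _ _

end Preadditive

variable (𝒞) in
/-- Evaluation of trans-comodules at an object. -/
@[simps]
def ev (x : X) : TransComod 𝒞 ⥤ RightComod K (𝒞.obj x) where
  obj M := M.obj x
  map f := f.app x

theorem isIso_of_bijective {M N : TransComod 𝒞} (f : M ⟶ N)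
    (hf : ∀ x, Function.Bijective (f.app x).toLin) : IsIso f := by
  have (x : X) : IsIso (f.app x) := RightComod.isIso_of_bijective _ (hf x)
  refine ⟨{ app := fun x => inv (f.app x), naturality := fun {x y} α => ?_ }, hom_ext fun x => ?_,
    hom_ext fun x => ?_⟩
  · rw [Functor.map_inv, IsIso.comp_inv_eq, Category.assoc, f.naturality, IsIso.inv_hom_id_assoc]
  · exact IsIso.hom_inv_id (f.app x)
  · exact IsIso.inv_hom_id (f.app x)

/-- The linear map underlying the structure morphism `_αM : M_y ⟶ α^* M_x`. -/
abbrev mapLin (M : TransComod 𝒞) {x y : X} (α : x ⟶ y) :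
    (M.obj y).carrier →ₗ[K] (M.obj x).carrier :=
  (M.map α).toLin

theorem mapLin_comm (M : TransComod 𝒞) {x y : X} (α : x ⟶ y) (m : (M.obj y).carrier) :
    (𝒞.map α).toCoalgHom.toLinearMap.lTensor _ ((M.obj x).coact (M.mapLin α m)) =
      (M.mapLin α).rTensor _ ((M.obj y).coact m) :=
  (M.map α).comm m

theorem app_mapLin {M N : TransComod 𝒞} (f : M ⟶ N) {x y : X} (α : x ⟶ y)
    (m : (M.obj y).carrier) :
    (f.app x).toLin (M.mapLin α m) = N.mapLin α ((f.app y).toLin m) :=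
  LinearMap.congr_fun (congrArg RightComod.Hom.toLin (f.naturality α)) m

/-! ### Sub-trans-comodules -/

section Sub

variable {M : TransComod 𝒞} {p : ∀ x, Submodule K (M.obj x).carrier}

/-- A family of subspaces of a trans-comodule is stable if it consists of stable subspaces and is
preserved by the structure morphisms. -/
structure IsStable (M : TransComod 𝒞) (p : ∀ x, Submodule K (M.obj x).carrier) : Prop where
  stable (x : X) : RightComod.IsStable (M.obj x) (p x)
  map_mem {x y : X} (α : x ⟶ y) (m : (M.obj y).carrier) (hm : m ∈ p y) : M.mapLin α m ∈ p x

/-- The restriction of a structure morphism to a stable family of subspaces. -/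
def subMapLin (h : IsStable M p) {x y : X} (α : x ⟶ y) : p y →ₗ[K] p x :=
  (M.mapLin α).restrict (h.map_mem α)

theorem subtype_comp_subMapLin (h : IsStable M p) {x y : X} (α : x ⟶ y) :
    (p x).subtype ∘ₗ subMapLin h α = M.mapLin α ∘ₗ (p y).subtype := rfl

/-- The sub-trans-comodule on a stable family of subspaces. -/
abbrev sub (h : IsStable M p) : TransComod 𝒞 where
  obj x := RightComod.sub (h.stable x)
  map {x y} α :=
    { toLin := subMapLin h α
      comm := fun m => by
        apply ComodAux.rTensor_injective (p x).subtype (p x).injective_subtype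
        rw [← LinearMap.rTensor_comp_apply, subtype_comp_subMapLin,
          LinearMap.rTensor_comp_apply, subtype_subCoact, ← mapLin_comm, LinearMap.comp_apply,
          ← ComodAux.lTensor_rTensor, subtype_subCoact]
        rfl }
  map_id x m := Subtype.ext (M.map_id x m)
  map_comp α β m := Subtype.ext (M.map_comp α β m)

/-- The inclusion of a sub-trans-comodule. -/
def subι (h : IsStable M p) : sub h ⟶ M where
  app x := RightComod.subι (h.stable x)
  naturality _ := rfl

/-- A morphism with values in a stable family of subspaces factors through the
sub-trans-comodule. -/
def subLift (h : IsStable M p) {N : TransComod 𝒞} (f : N ⟶ M)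
    (hf : ∀ x n, (f.app x).toLin n ∈ p x) : N ⟶ sub h where
  app x := RightComod.subLift (h.stable x) (f.app x) (hf x)
  naturality α := RightComod.hom_ext (LinearMap.ext fun n => Subtype.ext (app_mapLin f α n))

theorem isStable_ker {N : TransComod 𝒞} (f : M ⟶ N) :
    IsStable M (fun x => LinearMap.ker (f.app x).toLin) where
  stable x := RightComod.isStable_ker (f.app x)
  map_mem α m hm := LinearMap.mem_ker.2 <| (app_mapLin f α m).trans <|
    (congrArg (N.mapLin α) (LinearMap.mem_ker.1 hm)).trans (map_zero _)

/-- The kernel of a morphism of trans-comodules is the family of pointwise kernels. -/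
def isLimitKernelFork {N : TransComod 𝒞} (f : M ⟶ N) :
    IsLimit (KernelFork.ofι (f := f) (subι (isStable_ker f))
      (hom_ext fun _ => RightComod.hom_ext (LinearMap.ext fun m => m.2))) :=
  KernelFork.IsLimit.ofι _ _
    (fun g hg => subLift (isStable_ker f) g fun _ n =>
      LinearMap.congr_fun (congrArg RightComod.Hom.toLin (congrArg (Hom.app · _) hg)) n)
    (fun _ _ => rfl)
    (fun _ _ _ hb => hom_ext fun _ => RightComod.hom_ext (LinearMap.ext fun n => Subtype.ext
      (LinearMap.congr_fun (congrArg RightComod.Hom.toLin (congrArg (Hom.app · _) hb)) n)))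

end Sub

/-! ### Colimits of trans-comodules -/

section Colimits

variable {J : Type u} [SmallCategory J] (F : J ⥤ TransComod 𝒞)

/-- The structure morphism of the colimit of a diagram of trans-comodules. -/
def colimitMap {x y : X} (α : x ⟶ y) : RightComod.colimitObj (F ⋙ ev 𝒞 y) ⟶
    (corestrict (𝒞.map α).toCoalgHom).obj (RightComod.colimitObj (F ⋙ ev 𝒞 x)) :=
  (isColimitColimitCocone (F ⋙ ev 𝒞 y)).desc
    { pt := (corestrict (𝒞.map α).toCoalgHom).obj (RightComod.colimitObj (F ⋙ ev 𝒞 x))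
      ι :=
        { app := fun j => (F.obj j).map α ≫ (corestrict (𝒞.map α).toCoalgHom).map
            ((RightComod.colimitCocone (F ⋙ ev 𝒞 x)).ι.app j)
          naturality := fun _ j a => RightComod.hom_ext (LinearMap.ext fun m =>
            (congrArg (colimitι (F ⋙ ev 𝒞 x) j) (app_mapLin (F.map a) α m)).symm.trans
              (colimitι_map (F ⋙ ev 𝒞 x) a _)) } }

theorem ι_colimitMap {x y : X} (α : x ⟶ y) (j : J) :
    (RightComod.colimitCocone (F ⋙ ev 𝒞 y)).ι.app j ≫ colimitMap F α =
      (F.obj j).map α ≫ (corestrict (𝒞.map α).toCoalgHom).map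
        ((RightComod.colimitCocone (F ⋙ ev 𝒞 x)).ι.app j) :=
  (isColimitColimitCocone (F ⋙ ev 𝒞 y)).fac _ j

theorem colimitMap_ι {x y : X} (α : x ⟶ y) (j : J) (m : ((F.obj j).obj y).carrier) :
    (colimitMap F α).toLin (colimitι (F ⋙ ev 𝒞 y) j m) =
      colimitι (F ⋙ ev 𝒞 x) j (((F.obj j).map α).toLin m) :=
  LinearMap.congr_fun (congrArg RightComod.Hom.toLin (ι_colimitMap F α j)) m

/-- The colimit of a diagram of trans-comodules. -/
abbrev colimitObj : TransComod 𝒞 where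
  obj x := RightComod.colimitObj (F ⋙ ev 𝒞 x)
  map α := colimitMap F α
  map_id x := by
    refine LinearMap.congr_fun (f := (colimitMap F (𝟙 x)).toLin) (g := LinearMap.id)
      (colimit_lin_ext fun j m => ?_)
    refine (colimitMap_ι F (𝟙 x) j m).trans ?_
    exact congrArg (colimitι (F ⋙ ev 𝒞 x) j) ((F.obj j).map_id x m)
  map_comp {x y z} α β := by
    refine LinearMap.congr_fun (f := (colimitMap F (α ≫ β)).toLin)
      (g := (colimitMap F α).toLin ∘ₗ (colimitMap F β).toLin)
      (colimit_lin_ext fun j m => ?_)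
    refine (colimitMap_ι F (α ≫ β) j m).trans ?_
    refine (congrArg (colimitι (F ⋙ ev 𝒞 x) j) ((F.obj j).map_comp α β m)).trans ?_
    refine (colimitMap_ι F α j _).symm.trans ?_
    exact congrArg (colimitMap F α).toLin (colimitMap_ι F β j m).symm

/-- The colimit cocone of a diagram of trans-comodules. -/
abbrev colimitCocone : Cocone F where
  pt := colimitObj F
  ι :=
    { app := fun j =>
        { app := fun x => (RightComod.colimitCocone (F ⋙ ev 𝒞 x)).ι.app j
          naturality := fun α => (ι_colimitMap F α j).symm }
      naturality := fun _ _ a =>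
        hom_ext fun x => (RightComod.colimitCocone (F ⋙ ev 𝒞 x)).ι.naturality a }

/-- The colimit cocone of trans-comodules is a colimit. -/
def isColimitColimitCocone : IsColimit (colimitCocone F) where
  desc s :=
    { app := fun x => (RightComod.isColimitColimitCocone (F ⋙ ev 𝒞 x)).desc ((ev 𝒞 x).mapCocone s)
      naturality := fun {x y} α => by
        refine RightComod.hom_ext (colimit_lin_ext fun j m => ?_)
        refine (congrArg (colimitDescCocone ((ev 𝒞 x).mapCocone s)) (colimitMap_ι F α j m)).trans ?_
        refine (colimitDescCocone_ι ((ev 𝒞 x).mapCocone s) j _).trans ?_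
        refine (app_mapLin (s.ι.app j) α m).trans ?_
        exact congrArg (s.pt.mapLin α) (colimitDescCocone_ι ((ev 𝒞 y).mapCocone s) j m).symm }
  fac s j := hom_ext fun x =>
    (RightComod.isColimitColimitCocone (F ⋙ ev 𝒞 x)).fac ((ev 𝒞 x).mapCocone s) j
  uniq s f hf := hom_ext fun x =>
    (RightComod.isColimitColimitCocone (F ⋙ ev 𝒞 x)).uniq ((ev 𝒞 x).mapCocone s) (f.app x)
      fun j => congrArg (Hom.app · x) (hf j)

instance : HasColimitsOfSize.{u, u} (TransComod 𝒞) where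
  has_colimits_of_shape _ _ := { has_colimit := fun F => ⟨⟨⟨_, isColimitColimitCocone F⟩⟩⟩ }

end Colimits

/-! ### Cartesian trans-comodules -/

section Cartesian

variable [IsQuasiFiniteRep 𝒞]

theorem shriekMap_naturality {M N : TransComod 𝒞} (f : M ⟶ N) {x y : X} (α : x ⟶ y) :
    (shriek (𝒞.map α).toCoalgHom).map (f.app y) ≫ N.shriekMap α = M.shriekMap α ≫ f.app x := by
  rw [shriekMap, shriekMap, ← Adjunction.homEquiv_naturality_left_symm,
    ← Adjunction.homEquiv_naturality_right_symm, f.naturality]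

/-- The linear map underlying `^αM : α^! M_y ⟶ M_x`. -/
def shriekMapLin (M : TransComod 𝒞) {x y : X} (α : x ⟶ y) :
    (cohom (overCod (𝒞.map α).toCoalgHom)).obj (M.obj y) →ₗ[K] (M.obj x).carrier :=
  (M.shriekMap α).toLin

theorem shriekMapLin_naturality {M N : TransComod 𝒞} (f : M ⟶ N) {x y : X} (α : x ⟶ y)
    (h : (cohom (overCod (𝒞.map α).toCoalgHom)).obj (M.obj y)) :
    N.shriekMapLin α (shriekLin _ (f.app y) h) = (f.app x).toLin (M.shriekMapLin α h) :=
  LinearMap.congr_fun (congrArg RightComod.Hom.toLin (shriekMap_naturality f α)) h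

theorem isCartesian_iff (M : TransComod 𝒞) : IsCartesian 𝒞 M ↔
    ∀ ⦃x y : X⦄ (α : x ⟶ y), Function.Bijective (M.shriekMapLin α) :=
  ⟨fun h _ _ α => have := h α; RightComod.bijective_of_isIso (M.shriekMap α),
    fun h _ _ α => RightComod.isIso_of_bijective (M.shriekMap α) (h α)⟩

instance : (IsCartesian 𝒞).IsClosedUnderIsomorphisms where
  of_iso {M N} e hM := by
    intro x y α
    have := hM α
    have : IsIso (e.inv.app y) := ((ev 𝒞 y).mapIso e.symm).isIso_hom
    have : IsIso (e.hom.app x) := ((ev 𝒞 x).mapIso e).isIso_hom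
    have h : N.shriekMap α = (shriek (𝒞.map α).toCoalgHom).map (e.inv.app y) ≫
        M.shriekMap α ≫ e.hom.app x := by
      rw [← Category.assoc, shriekMap_naturality, Category.assoc, ← comp_app, e.inv_hom_id,
        id_app, Category.comp_id]
    rw [h]
    infer_instance

/-- A colimit of cartesian trans-comodules is cartesian. -/
theorem isCartesian_colimitObj {J : Type u} [SmallCategory J] (F : J ⥤ TransComod 𝒞)
    (hF : ∀ j, IsCartesian 𝒞 (F.obj j)) : IsCartesian 𝒞 (colimitObj F) := by
  intro x y α
  let i (j : J) : (shriek (𝒞.map α).toCoalgHom).obj ((F.obj j).obj y) ≅ (F.obj j).obj x :=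
    have := hF j α
    asIso ((F.obj j).shriekMap α)
  -- Both sides of `^αM` at the colimit are therefore colimits of isomorphic diagrams; compatibility
  -- with the cocone legs identifies `^αM` with the induced isomorphism.
  have : PreservesColimits (shriek (𝒞.map α).toCoalgHom) :=
    (shriekAdj (𝒞.map α).toCoalgHom).leftAdjoint_preservesColimits
  let hy := isColimitOfPreserves (shriek (𝒞.map α).toCoalgHom)
    (RightComod.isColimitColimitCocone (F ⋙ ev 𝒞 y))
  let hx := RightComod.isColimitColimitCocone (F ⋙ ev 𝒞 x)
  let τ : (F ⋙ ev 𝒞 y) ⋙ shriek (𝒞.map α).toCoalgHom ≅ F ⋙ ev 𝒞 x :=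
    NatIso.ofComponents i fun a => shriekMap_naturality (F.map a) α
  let e := IsColimit.coconePointsIsoOfNatIso hy hx τ
  have he : (colimitObj F).shriekMap α = e.hom := hy.hom_ext fun j =>
    (shriekMap_naturality ((colimitCocone F).ι.app j) α).trans
      (IsColimit.comp_coconePointsIsoOfNatIso_hom hy hx τ j).symm
  rw [he]
  infer_instance

instance (J : Type u) [SmallCategory J] : (IsCartesian 𝒞).IsClosedUnderColimitsOfShape J where
  colimitsOfShape_le := by
    rintro M ⟨h⟩
    exact (IsCartesian 𝒞).prop_of_iso
      ((isColimitColimitCocone h.diag).coconePointUniqueUpToIso h.isColimit)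
      (isCartesian_colimitObj h.diag h.prop_diag_obj)

/-- Only surjectivity has to be assumed: `α^!` preserves the injection `p y → M_y` and `^αM` is
bijective, so the structure map of the subobject is injective for free. -/
theorem isCartesian_sub (hinj : IsSigmaInjectiveRep 𝒞) {M : TransComod 𝒞} (hM : IsCartesian 𝒞 M)
    {p : ∀ x, Submodule K (M.obj x).carrier} (hp : IsStable M p)
    (h : ∀ ⦃x y : X⦄ (α : x ⟶ y), ∀ m ∈ p x, ∃ t,
      M.shriekMapLin α (shriekLin _ (RightComod.subι (hp.stable y)) t) = m) :
    IsCartesian 𝒞 (sub hp) := by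
  rw [isCartesian_iff] at hM ⊢
  intro x y α
  have hn (t) : M.shriekMapLin α (shriekLin _ (RightComod.subι (hp.stable y)) t) =
      (p x).subtype ((sub hp).shriekMapLin α t) := shriekMapLin_naturality (subι hp) α t
  constructor
  · intro s t hst
    apply (hinj α).shriekLin_injective (RightComod.subι (hp.stable y)) (p y).injective_subtype
    apply (hM α).1
    rw [hn, hn, hst]
  · intro m
    obtain ⟨t, ht⟩ := h α m m.2
    exact ⟨t, Subtype.ext ((hn t).symm.trans ht)⟩

/-- A kernel of a morphism of cartesian trans-comodules is cartesian. -/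
theorem isCartesian_ker (hinj : IsSigmaInjectiveRep 𝒞) {M N : TransComod 𝒞}
    (hM : IsCartesian 𝒞 M) (hN : IsCartesian 𝒞 N) (f : M ⟶ N) :
    IsCartesian 𝒞 (sub (isStable_ker f)) := by
  refine isCartesian_sub hinj hM _ fun x y α m hm => ?_
  rw [isCartesian_iff] at hM hN
  obtain ⟨s, rfl⟩ := (hM α).2 m
  -- By naturality `^αN` kills `α^!(f_y) s`, and `^αN` is injective, so `s` lies in the kernel of
  -- `α^!(f_y)`. Exactness lifts it to `α^!` of `ker f_y`.
  obtain ⟨t, rfl⟩ := (hinj α).exact (RightComod.subι (RightComod.isStable_ker (f.app y))) (f.app y)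
    (fun n hn => ⟨⟨n, hn⟩, rfl⟩) s ((hN α).1 <| by
      rw [shriekMapLin_naturality, map_zero]
      exact hm)
  exact ⟨t, rfl⟩

end Cartesian

end TransComod

namespace TransComod

open Limits RightComod

variable {K : Type u} [Field K] {X : Type u} [Category.{u} X] {𝒞 : X ⥤ CoalgCat.{u} K}

/-! ### The underlying family of vector spaces -/

variable (𝒞) in
/-- The family of the underlying vector spaces of a trans-comodule. -/
@[simps]
def toFamily : TransComod 𝒞 ⥤ Discrete X ⥤ ModuleCat.{u} K where
  obj M := Discrete.functor fun x => ModuleCat.of K (M.obj x).carrier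
  map f := Discrete.natTrans fun x => ModuleCat.ofHom (f.app x.as).toLin

instance : (toFamily 𝒞).ReflectsIsomorphisms where
  reflects f _ := isIso_of_bijective f fun x =>
    ConcreteCategory.bijective_of_isIso (((toFamily 𝒞).map f).app ⟨x⟩)

instance : (toFamily 𝒞).Additive where
  map_add := rfl

instance {J : Type u} [SmallCategory J] : PreservesColimitsOfShape J (toFamily 𝒞) where
  preservesColimit {F} := preservesColimit_of_preserves_colimit_cocone (isColimitColimitCocone F)
    (evaluationJointlyReflectsColimits _ fun x =>
      isColimitForgetColimitCocone (F ⋙ ev 𝒞 x.as))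

instance : PreservesColimitsOfSize.{u, u} (toFamily 𝒞) where

instance {M N : TransComod 𝒞} (f : M ⟶ N) : PreservesLimit (parallelPair f 0) (toFamily 𝒞) :=
  preservesLimit_of_preserves_limit_cone (isLimitKernelFork f)
    (evaluationJointlyReflectsLimits _ fun x =>
      (KernelFork.isLimitMapConeEquiv _ (toFamily 𝒞 ⋙ (evaluation _ _).obj x)).symm
        (ModuleCat.isLimitKernelFork (ModuleCat.ofHom ((f.app x.as).toLin.ker.subtype))
          (ModuleCat.ofHom (f.app x.as).toLin) (LinearMap.exact_subtype_ker_map _)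
          (Submodule.injective_subtype _)))

instance : HasKernels (TransComod 𝒞) where
  has_limit f := ⟨⟨⟨_, isLimitKernelFork f⟩⟩⟩

/-! ### The category of cartesian trans-comodules -/

section Cartesian

variable [IsQuasiFiniteRep 𝒞]

variable (𝒞) in
/-- The family of the underlying vector spaces of a cartesian trans-comodule. -/
abbrev Cartesian.toFamily : Cartesian 𝒞 ⥤ Discrete X ⥤ ModuleCat.{u} K :=
  (IsCartesian 𝒞).ι ⋙ TransComod.toFamily 𝒞

instance : HasColimitsOfSize.{u, u} (Cartesian 𝒞) where
  has_colimits_of_shape _ _ := inferInstance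

instance : PreservesColimitsOfSize.{u, u} (Cartesian.toFamily 𝒞) where
  preservesColimitsOfShape := inferInstance

instance : HasFiniteColimits (Cartesian 𝒞) :=
  hasFiniteColimits_of_hasColimitsOfSize.{u, u} _

instance : HasFiniteBiproducts (Cartesian 𝒞) := HasFiniteBiproducts.of_hasFiniteCoproducts

instance : (Cartesian.toFamily 𝒞).ReflectsIsomorphisms where
  reflects f _ := by
    have : IsIso ((TransComod.toFamily 𝒞).map f.hom) := ‹_›
    exact ((IsCartesian 𝒞).isIso_hom_iff f).1
      (isIso_of_reflects_iso f.hom (TransComod.toFamily 𝒞))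

instance : (Cartesian.toFamily 𝒞).Additive where
  map_add := rfl

theorem isClosedUnderKernels (hinj : IsSigmaInjectiveRep 𝒞) :
    (IsCartesian 𝒞).IsClosedUnderKernels where
  kernels_le := by
    rintro _ ⟨f, k, hk, hM, hN⟩
    exact (IsCartesian 𝒞).prop_of_iso ((isLimitKernelFork f).conePointUniqueUpToIso hk)
      (isCartesian_ker hinj hM hN f)

/-- Closure under kernels makes the inclusion into all trans-comodules preserve them, and there they
are pointwise. -/
theorem Cartesian.preservesKernels_toFamily (hinj : IsSigmaInjectiveRep 𝒞) {M N : Cartesian 𝒞}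
    (f : M ⟶ N) : PreservesLimit (parallelPair f 0) (toFamily 𝒞) := by
  have := isClosedUnderKernels hinj
  have := (IsCartesian 𝒞).preservesKernels_ι f
  have : PreservesLimit (parallelPair f 0 ⋙ (IsCartesian 𝒞).ι) (TransComod.toFamily 𝒞) :=
    preservesLimit_of_iso_diagram (K₁ := parallelPair f.hom 0) (TransComod.toFamily 𝒞)
      (diagramIsoParallelPair (parallelPair f 0 ⋙ (IsCartesian 𝒞).ι)).symm
  exact comp_preservesLimit _ _

/-- The category of cartesian trans-comodules is abelian. -/
@[reducible]
def Cartesian.abelian (hinj : IsSigmaInjectiveRep 𝒞) : Abelian (Cartesian 𝒞) :=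
  have := isClosedUnderKernels hinj
  have {M N : Cartesian 𝒞} (f : M ⟶ N) := Cartesian.preservesKernels_toFamily hinj f
  abelianOfReflectsIsomorphisms (toFamily 𝒞)

/-- Filtered colimits of cartesian trans-comodules are exact. -/
theorem Cartesian.ab5 (hinj : IsSigmaInjectiveRep 𝒞) : AB5OfSize.{u, u} (Cartesian 𝒞) := by
  let := Cartesian.abelian hinj
  have {M N : Cartesian 𝒞} (f : M ⟶ N) := Cartesian.preservesKernels_toFamily hinj f
  have : HasBinaryBiproducts (Cartesian 𝒞) := hasBinaryBiproducts_of_finite_biproducts _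
  -- An additive functor preserving kernels preserves finite limits. Being conservative and
  -- compatible with colimits as well, it reflects the exactness of filtered colimits from families
  -- of vector spaces.
  have : PreservesFiniteLimits (toFamily 𝒞) :=
    (toFamily 𝒞).preservesFiniteLimits_of_preservesKernels
  exact ⟨fun J _ _ => HasExactColimitsOfShape.domain_of_functor J (toFamily 𝒞)⟩

end Cartesian

end TransComod

/-! ### Finiteness of coactions -/

namespace RightComod

variable {K : Type u} [Field K]
variable {C : Type u} [AddCommGroup C] [Module K C] [Coalgebra K C]

/-- The coaction of an element only involves finitely many elements. -/
theorem exists_finite_coact_mem (M : RightComod K C) (m : M.carrier) :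
    ∃ T : Set M.carrier, T.Finite ∧ ∀ p : Submodule K M.carrier, T ⊆ p →
      M.coact m ∈ LinearMap.range (p.subtype.rTensor C) := by
  induction M.coact m using TensorProduct.induction_on with
  | zero => exact ⟨∅, Set.finite_empty, fun p _ => Submodule.zero_mem _⟩
  | add s t hs ht =>
    obtain ⟨S, hS, hS'⟩ := hs
    obtain ⟨T, hT, hT'⟩ := ht
    exact ⟨S ∪ T, hS.union hT, fun p h => Submodule.add_mem _
      (hS' p (Set.subset_union_left.trans h)) (hT' p (Set.subset_union_right.trans h))⟩
  | tmul a c => exact ⟨{a}, Set.finite_singleton a, fun p h => ⟨⟨a, h rfl⟩ ⊗ₜ c, rfl⟩⟩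

end RightComod

/-- A finite subset of a pointed type is contained in the range of a sequence. -/
theorem Set.Finite.exists_subset_range {A : Type u} [Inhabited A] {T : Set A} (hT : T.Finite) :
    ∃ g : ℕ → A, T ⊆ Set.range g := by
  -- The inserted default element covers the case of empty `T`, which is not the range of a
  -- sequence.
  obtain ⟨g, hg⟩ := (hT.insert default).countable.exists_eq_range ⟨_, Set.mem_insert _ _⟩
  exact ⟨g, hg ▸ Set.subset_insert _ _⟩

/-! ### Closure under a family of partial operations -/

section Words

variable {X : Type u} {A : X → Type u} {I : X → Type u} (op : ∀ x, A x → I x → Σ x, A x)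

/-- One step of the closure under the operations `op`. -/
def wordStep (e : Σ x, A x) : (Σ x, I x) → Σ x, A x :=
  -- A letter based at the object of `e` acts through `op`; any other letter leaves `e` unchanged.
  Function.extend (Sigma.mk e.1) (op e.1 e.2) fun _ => e

/-- The element obtained from `e` by applying a word in the operations `op`. -/
def wordEval (e : Σ x, A x) (l : List (Σ x, I x)) : Σ x, A x :=
  l.foldl (wordStep op) e

/-- The last letter does act, because it is based at the object where the word `l` ends. Hence the
values of words are closed under `op`. -/
theorem wordEval_append (e : Σ x, A x) (l : List (Σ x, I x)) {x : X} {a : A x}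
    (h : wordEval op e l = ⟨x, a⟩) (i : I x) : wordEval op e (l ++ [⟨x, i⟩]) = op x a i := by
  have h' : wordEval op e (l ++ [⟨x, i⟩]) = wordStep op (wordEval op e l) ⟨x, i⟩ := by
    simp [wordEval]
  rw [h', h]
  exact sigma_mk_injective.extend_apply _ _ i

end Words

namespace TransComod

open Limits RightComod

variable {K : Type u} [Field K] {X : Type u} [Category.{u} X] {𝒞 : X ⥤ CoalgCat.{u} K}

/-! ### Small cartesian sub-trans-comodules -/

/-- A trans-comodule is spanned by `L` if all its terms are quotients of `L →₀ K`. -/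
def IsSpannedBy (L : Type u) (M : TransComod 𝒞) : Prop :=
  ∀ x, ∃ q : (L →₀ K) →ₗ[K] (M.obj x).carrier, Function.Surjective q

section Cartesian

variable [IsQuasiFiniteRep 𝒞]

variable (X) in
/-- The operations at `x` needed to generate cartesian sub-trans-comodules. -/
abbrev OpIndex (x : X) : Type u := ℕ ⊕ (Σ w, w ⟶ x) ⊕ ((Σ y, x ⟶ y) × ℕ)

/-- The spanning set consists of words whose alphabet depends on `X` alone, so the bound on the size
of the subobject is uniform in `M` and `m₀`. -/
theorem exists_cartesian_sub (hinj : IsSigmaInjectiveRep 𝒞) {M : TransComod 𝒞}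
    (hM : IsCartesian 𝒞 M) (x₀ : X) (m₀ : (M.obj x₀).carrier) :
    ∃ (p : ∀ x, Submodule K (M.obj x).carrier) (hp : IsStable M p),
      IsCartesian 𝒞 (sub hp) ∧ IsSpannedBy (List (Σ x, OpIndex X x)) (sub hp) ∧ m₀ ∈ p x₀ := by
  have hc (x : X) (m : (M.obj x).carrier) : ∃ g : ℕ → (M.obj x).carrier,
      ∀ p : Submodule K (M.obj x).carrier, (∀ n, g n ∈ p) →
        (M.obj x).coact m ∈ LinearMap.range (p.subtype.rTensor (𝒞.obj x)) := by
    obtain ⟨T, hT, hT'⟩ := (M.obj x).exists_finite_coact_mem m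
    have : Inhabited (M.obj x).carrier := ⟨0⟩
    obtain ⟨g, hg⟩ := hT.exists_subset_range
    exact ⟨g, fun p hp => hT' p (hg.trans (Set.range_subset_iff.2 hp))⟩
  -- A preimage of `m` under `^αM` needs only finitely many elements of `M_y`. Putting them into `p
  -- y` yields the surjectivity required by `isCartesian_sub`.
  have hd (x : X) (m : (M.obj x).carrier) (y : X) (α : x ⟶ y) : ∃ g : ℕ → (M.obj y).carrier,
      ∀ (p : Submodule K (M.obj y).carrier) (hp : RightComod.IsStable (M.obj y) p),
        (∀ n, g n ∈ p) →
          m ∈ LinearMap.range (M.shriekMapLin α ∘ₗ shriekLin _ (RightComod.subι hp)) := by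
    obtain ⟨h, rfl⟩ := ((isCartesian_iff M).1 hM α).2 m
    obtain ⟨T, hT, hT'⟩ := exists_finite_support (M.obj y) h
    have : Inhabited (M.obj y).carrier := ⟨0⟩
    obtain ⟨g, hg⟩ := hT.exists_subset_range
    refine ⟨g, fun p hp h' => ?_⟩
    obtain ⟨t, rfl⟩ := hT' p hp (hg.trans (Set.range_subset_iff.2 h'))
    exact ⟨t, rfl⟩
  choose c hc using hc
  choose d hd using hd
  -- The three kinds of operation secure, in order, stability under the coaction, stability under
  -- the structure maps, and the cartesian property.
  let op (x : X) (m : (M.obj x).carrier) : OpIndex X x → Σ x, (M.obj x).carrier :=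
    Sum.elim (fun n => ⟨x, c x m n⟩)
      (Sum.elim (fun a => ⟨a.1, M.mapLin a.2 m⟩) (fun a => ⟨a.1.1, d x m a.1.1 a.1.2 a.2⟩))
  let E (x : X) : Set (M.obj x).carrier := {m | ∃ l, wordEval op ⟨x₀, m₀⟩ l = ⟨x, m⟩}
  have hE {x : X} {m : (M.obj x).carrier} (hm : m ∈ E x) (i : OpIndex X x) :
      (op x m i).2 ∈ E (op x m i).1 := by
    obtain ⟨l, hl⟩ := hm
    exact ⟨_, wordEval_append op _ l hl i⟩
  let p (x : X) : Submodule K (M.obj x).carrier := Submodule.span K (E x)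
  have hp : IsStable M p :=
    { stable := fun x => Submodule.span_le (p := (LinearMap.range
          ((p x).subtype.rTensor (𝒞.obj x))).comap (M.obj x).coact).2 fun m hm =>
        hc x m _ fun n => Submodule.subset_span (hE hm (Sum.inl n))
      map_mem := fun {x y} α => Submodule.span_le (p := (p x).comap (M.mapLin α)).2 fun m hm =>
        Submodule.subset_span (hE hm (Sum.inr (Sum.inl ⟨x, α⟩))) }
  refine ⟨p, hp, isCartesian_sub hinj hM hp fun x y α => ?_, fun x => ?_,
    Submodule.subset_span ⟨[], rfl⟩⟩
  · exact Submodule.span_le (p := LinearMap.range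
      (M.shriekMapLin α ∘ₗ shriekLin _ (RightComod.subι (hp.stable y)))).2 fun m hm =>
        hd x m y α _ _ fun n => Submodule.subset_span (hE hm (Sum.inr (Sum.inr (⟨y, α⟩, n))))
  · classical
    -- A word is sent to its value if that lies over `x`, and to zero otherwise.
    let w (l : List (Σ x, OpIndex X x)) : p x :=
      if h : ∃ m, wordEval op ⟨x₀, m₀⟩ l = ⟨x, m⟩ then
        ⟨h.choose, Submodule.subset_span ⟨l, h.choose_spec⟩⟩ else 0
    refine ⟨Finsupp.linearCombination K w, LinearMap.range_eq_top.1 ?_⟩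
    rw [Finsupp.range_linearCombination]
    refine Submodule.map_injective_of_injective (p x).injective_subtype ?_
    rw [Submodule.map_subtype_top, Submodule.map_span]
    refine le_antisymm (Submodule.span_le.2 ?_) (Submodule.span_mono ?_)
    · rintro _ ⟨a, -, rfl⟩
      exact a.2
    · rintro m ⟨l, hl⟩
      have h : ∃ m, wordEval op ⟨x₀, m₀⟩ l = ⟨x, m⟩ := ⟨m, hl⟩
      refine ⟨w l, ⟨l, rfl⟩, ?_⟩
      simp only [w, dif_pos h]
      exact sigma_mk_injective (β := fun x => (M.obj x).carrier) (h.choose_spec.symm.trans hl)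

end Cartesian

/-! ### A separator -/

variable (𝒞) in
/-- The data of a trans-comodule on quotients of `L →₀ K`. -/
structure QuotData (L : Type u) : Type u where
  ker (x : X) : Submodule K (L →₀ K)
  coact (x : X) : ((L →₀ K) ⧸ ker x) →ₗ[K] ((L →₀ K) ⧸ ker x) ⊗[K] (𝒞.obj x)
  map {x y : X} (α : x ⟶ y) : ((L →₀ K) ⧸ ker y) →ₗ[K] ((L →₀ K) ⧸ ker x)

/-- A presentation of a trans-comodule by quotients of `L →₀ K`. -/
structure QuotData.Presents {L : Type u} (d : QuotData 𝒞 L) (M : TransComod 𝒞) where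
  equiv (x : X) : ((L →₀ K) ⧸ d.ker x) ≃ₗ[K] (M.obj x).carrier
  coact_equiv (x : X) (b) :
    (M.obj x).coact (equiv x b) = (equiv x).toLinearMap.rTensor _ (d.coact x b)
  map_equiv {x y : X} (α : x ⟶ y) (b) : M.mapLin α (equiv y b) = equiv x (d.map α b)

/-- Transport of structure along the isomorphisms `(L →₀ K) ⧸ ker q ≃ M_x`. Since `QuotData 𝒞 L`
lives in `Type u`, this leaves only a set of isomorphism classes of trans-comodules spanned by `L`.
-/
theorem IsSpannedBy.exists_presents {L : Type u} {M : TransComod 𝒞} (h : IsSpannedBy L M) :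
    ∃ d : QuotData 𝒞 L, Nonempty (d.Presents M) := by
  choose q hq using h
  let e (x : X) := (q x).quotKerEquivOfSurjective (hq x)
  refine ⟨⟨fun x => LinearMap.ker (q x),
    fun x => (e x).symm.toLinearMap.rTensor _ ∘ₗ (M.obj x).coact ∘ₗ (e x).toLinearMap,
    fun {x y} α => (e x).symm.toLinearMap ∘ₗ M.mapLin α ∘ₗ (e y).toLinearMap⟩,
    ⟨e, fun x b => ?_, fun α b => ?_⟩⟩
  · have h : (e x).toLinearMap ∘ₗ (e x).symm.toLinearMap = LinearMap.id :=
      LinearMap.ext (e x).apply_symm_apply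
    rw [LinearMap.comp_apply, ← LinearMap.rTensor_comp_apply, h, LinearMap.rTensor_id]
    rfl
  · exact ((e _).apply_symm_apply _).symm

/-- Two trans-comodules with the same presentation are related by a morphism. -/
def QuotData.Presents.hom {L : Type u} {d : QuotData 𝒞 L} {M N : TransComod 𝒞}
    (f : d.Presents M) (g : d.Presents N) : M ⟶ N where
  app x :=
    { toLin := (g.equiv x).toLinearMap ∘ₗ (f.equiv x).symm.toLinearMap
      comm := fun m => by
        obtain ⟨b, rfl⟩ := (f.equiv x).surjective m
        have h : (f.equiv x).symm.toLinearMap ∘ₗ (f.equiv x).toLinearMap = LinearMap.id :=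
          LinearMap.ext (f.equiv x).symm_apply_apply
        rw [LinearMap.rTensor_comp_apply, f.coact_equiv,
          ← LinearMap.rTensor_comp_apply _ (f.equiv x).symm.toLinearMap, h, LinearMap.rTensor_id,
          LinearMap.id_apply, ← g.coact_equiv]
        exact congrArg (fun b => (N.obj x).coact (g.equiv x b)) ((f.equiv x).symm_apply_apply b) }
  naturality {x y} α := RightComod.hom_ext <| LinearMap.ext fun m => by
    obtain ⟨b, rfl⟩ := (f.equiv y).surjective m
    change g.equiv x ((f.equiv x).symm (M.mapLin α (f.equiv y b))) =
      N.mapLin α (g.equiv y ((f.equiv y).symm (f.equiv y b)))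
    rw [f.map_equiv, LinearEquiv.symm_apply_apply, LinearEquiv.symm_apply_apply, g.map_equiv]

theorem QuotData.Presents.hom_surjective {L : Type u} {d : QuotData 𝒞 L} {M N : TransComod 𝒞}
    (f : d.Presents M) (g : d.Presents N) (x : X) :
    Function.Surjective ((f.hom g).app x).toLin :=
  (g.equiv x).surjective.comp (f.equiv x).symm.surjective

variable [IsQuasiFiniteRep 𝒞]

/-- The category of cartesian trans-comodules has a separator. -/
theorem Cartesian.hasSeparator (hinj : IsSigmaInjectiveRep 𝒞) : HasSeparator (Cartesian 𝒞) := by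
  -- `QuotData` carries no comodule axioms, so only those data are kept that present some cartesian
  -- trans-comodule; `f` picks one for each.
  let S : Type u := {d : QuotData 𝒞 (List (Σ x, OpIndex X x)) //
    ∃ M : Cartesian 𝒞, Nonempty (d.Presents M.obj)}
  let f (d : S) : Cartesian 𝒞 := d.2.choose
  have hf (d : S) : Nonempty (d.1.Presents (f d).obj) := d.2.choose_spec
  refine ⟨∐ f, (isSeparator_sigma f).2 fun M N g h hgh => ?_⟩
  refine ObjectProperty.hom_ext _ (hom_ext fun x => RightComod.hom_ext (LinearMap.ext fun m => ?_))
  -- To compare `g` and `h` at `m`, a small cartesian subobject containing `m` is chosen. The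
  -- representative with the same presentation maps onto it, so `m` is in the image of a morphism on
  -- which `g` and `h` agree.
  obtain ⟨p, hp, hcart, hspan, hm⟩ := exists_cartesian_sub hinj M.2 x m
  obtain ⟨d, ⟨e⟩⟩ := hspan.exists_presents
  let d' : S := ⟨d, ⟨_, hcart⟩, ⟨e⟩⟩
  obtain ⟨e'⟩ := hf d'
  obtain ⟨a, ha⟩ := e'.hom_surjective e x ⟨m, hm⟩
  have h := hgh (f d') (ObjectProperty.ofObj_apply f d') (ObjectProperty.homMk (e'.hom e ≫ subι hp))
  have h' := LinearMap.congr_fun (congrArg (fun k => (Hom.app k.hom x).toLin) h) a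
  have ha' : ((subι hp).app x).toLin (((e'.hom e).app x).toLin a) = m :=
    congrArg ((subι hp).app x).toLin ha
  rw [← ha']
  exact h'

end TransComod

end

/-! ### The Grothendieck property -/

theorem mainTheorem6 {K : Type u} [Field K] {X : Type u} [PartialOrder X]
    (𝒞 : X ⥤ CoalgCat.{u} K) [IsQuasiFiniteRep 𝒞] (hinj : IsSigmaInjectiveRep 𝒞)
    (hsp : ∀ x : X, RightComod.IsRightSemiperfect K (𝒞.obj x)) :
    ∃ _ : Abelian (TransComod.Cartesian 𝒞),
      IsGrothendieckAbelian.{u} (TransComod.Cartesian 𝒞) := by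
  let := TransComod.Cartesian.abelian hinj
  exact ⟨inferInstance,
    { ab5OfSize := TransComod.Cartesian.ab5 hinj
      hasSeparator := TransComod.Cartesian.hasSeparator hinj }⟩
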